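/- Let $p>1$ be a computable real number. For $\sigma>0$ let $\mathcal B_\sigma^p$ be the Bernstein space of all entire functions $f$ of exponential type at most $\sigma$ whose restriction to $\mathbb R$ is bounded, vanishes at infinity and lies in $L^p(\mathbb R)$, normed by the $L^p(\mathbb R)$-norm; let $\ell^p=\ell^p(\mathbb Z)$ be the space of $p$-th power summable complex sequences. Let $S_p:\mathcal B_\pi^p\to\ell^p$, $f\mapsto (f(k))_{k\in\mathbb Z}$, be the sampling operator and $T_p:\operatorname{img}(S_p)\to\mathcal B_\pi^p$ its inverse, the interpolation operator. A computable sequence of finite tuples of computable complex numbers is given by programs that compute natural numbers $L(n)$ and, uniformly in $n$ and $k$, rational approximations of the real and imaginary parts of numbers $c_{n,k}$, $|k|\le L(n)$, each together with a modulus of convergence. A discrete-time description $\mathfrak X=((x_n)_n,\xi')$ of $x\in\ell^p$ consists of such programs, which define the finitely supported sequences $x_n$ with $x_n(k)=c_{n,k}$ for $|k|\le L(n)$ and $x_n(k)=0$ otherwise, and of a program for a total function $\xi':\mathbb N\to\mathbb N$ such that $\|x-x_n\|_{\ell^p}\le 2^{-M}$ for all $n,M\in\mathbb N$ with $n\ge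 \xi'(M)$. A continuous-time description $\mathfrak F=((f_n)_n,\xi)$ of $f\in\mathcal B_\pi^p$ consists of such programs, which define the finite sampling series $f_n(z)=\sum_{|k|\le L(n)}c_{n,k}\operatorname{sinc}(z-k)$, where $\operatorname{sinc}(z)=\sin(\pi z)/(\pi z)$ for $z\neq 0$ and $\operatorname{sinc}(0)=1$, and of a program for a total function $\xi:\mathbb N\to\mathbb N$ such that $\|f-f_n\|_{L^p(\mathbb R)}\le 2^{-M}$ for all $n,M\in\mathbb N$ with $n\ge\xi(M)$. Then the following hold. (1) $T_p$ is computable: there is a Turing machine that transforms every discrete-time description (of an element of $\ell^p$) into a continuous-time description (of an element of $\mathcal B_\pi^p$), and that transforms every discrete-time description of $S_pf$, for any $f\in\mathcal B_\pi^p$, into a continuous-time description of $f$. (2) There is a constant $C_R>0$ such that $\|f\|_{L^p(\mathbb R)}^p\le C_R\sum_{k\in\mathbb Z}|f(k)|^p$ for all $f\in\mathcal B_\pi^p$. For every such $C_R$, the Turing machine in (1) can be chosen so that, on each input $\mathfrak X=((x_n)_n,\xi')$ that is a discrete-time description, its output is $((f_n)_n,\xi)$ with $f_n=T_px_n$ for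 all $n$ and $\xi(M)=\xi'(\max\{0,\lceil\log_2 C_R\rceil\}+M)$ for all $M$. -/

import Mathlib

open MeasureTheory Filter Topology
open scoped ENNReal

/-! ### Bandlimited signals, sequences, sampling -/

/-- `sinc z = sin (π z) / (π z)` for `z ≠ 0`, and `sinc 0 = 1`, on the complex plane. -/
noncomputable def csinc (z : ℂ) : ℂ :=
  if z = 0 then 1 else Complex.sin (Real.pi * z) / (Real.pi * z)

/-- Entire functions of exponential type at most `σ`. -/
def IsEntireOfExpType (σ : ℝ) (f : ℂ → ℂ) : Prop :=
  Differentiable ℂ f ∧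
    ∀ ε : ℝ, 0 < ε → ∃ A : ℝ, ∀ z : ℂ, ‖f z‖ ≤ A * Real.exp ((σ + ε) * ‖z‖)

/-- The space `B_σ^∞`: entire functions of exponential type at most `σ` whose restriction to the
real line is essentially bounded and vanishes at infinity. -/
def bernsteinSpaceTop (σ : ℝ) : Set (ℂ → ℂ) :=
  {f | IsEntireOfExpType σ f ∧ MemLp (fun t : ℝ => f t) ∞ volume ∧
    Tendsto (fun t : ℝ => f t) (cocompact ℝ) (𝓝 0)}

/-- The Bernstein space `B_σ^p` for a real exponent `p`: the functions in `B_σ^∞` whose restriction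
to the real line is in `L^p(ℝ)`. -/
def bernsteinSpace (σ p : ℝ) : Set (ℂ → ℂ) :=
  {f | f ∈ bernsteinSpaceTop σ ∧ MemLp (fun t : ℝ => f t) (ENNReal.ofReal p) volume}

/-- The norm `‖f‖_p = (∫_ℝ |f(t)|^p dt)^(1/p)`, with values in `[0, ∞]`. -/
noncomputable def bernsteinNorm (p : ℝ) (f : ℂ → ℂ) : ℝ≥0∞ :=
  eLpNorm (fun t : ℝ => f t) (ENNReal.ofReal p) volume

/-- The space `ℓ^p(ℤ)` for a real exponent `p`. -/
def ellSpace (p : ℝ) : Set (ℤ → ℂ) :=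
  {x | MemLp x (ENNReal.ofReal p) Measure.count}

/-- The norm `‖x‖_{ℓ^p} = (∑_k |x(k)|^p)^(1/p)`, with values in `[0, ∞]`. -/
noncomputable def ellNorm (p : ℝ) (x : ℤ → ℂ) : ℝ≥0∞ :=
  eLpNorm x (ENNReal.ofReal p) Measure.count

/-- Sampling at the integers, `f ↦ (f(k))_{k ∈ ℤ}`. -/
def sampling (f : ℂ → ℂ) : ℤ → ℂ := fun k => f k

/-- `C` is a constant for the right-hand Plancherel-Pólya inequality:
`‖f‖_p^p ≤ C ∑_k |f(k)|^p` for all `f ∈ B_π^p`. -/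
def PlancherelPolyaRight (p C : ℝ) : Prop :=
  ∀ f ∈ bernsteinSpace Real.pi p,
    ∫⁻ t : ℝ, ‖f t‖ₑ ^ p ≤ ENNReal.ofReal C * ∑' k : ℤ, ‖sampling f k‖ₑ ^ p

/-- The finitely supported sequence with the entries `c 0, …, c (2 L)` at the places `-L, …, L`. -/
def finiteSeq (L : ℕ) (c : ℕ → ℂ) : ℤ → ℂ :=
  fun k => if -(L : ℤ) ≤ k ∧ k ≤ (L : ℤ) then c (k + L).toNat else 0

/-- The finite Shannon sampling series with the coefficients `c 0, …, c (2 L)` at the places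
`-L, …, L`. -/
noncomputable def finiteSamplingSeries (L : ℕ) (c : ℕ → ℂ) : ℂ → ℂ :=
  fun z => ∑ k ∈ Finset.Icc (-(L : ℤ)) L, c (k + L).toNat * csinc (z - k)

/-! ### Computable numbers -/

/-- Computable sequences of rational numbers: `r n = (-1)^(s n) * a n / b n` with total recursive
functions `s`, `a`, `b`. -/
def IsComputableRatSeq (r : ℕ → ℚ) : Prop :=
  ∃ s a b : ℕ → ℕ, Computable s ∧ Computable a ∧ Computable b ∧
    ∀ n, b n ≠ 0 ∧ r n = (-1) ^ s n * (a n : ℚ) / (b n : ℚ)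

/-- Computable real numbers: limits of computable sequences of rational numbers with a recursive
modulus of convergence. -/
def IsComputableReal (x : ℝ) : Prop :=
  ∃ (r : ℕ → ℚ) (ξ : ℕ → ℕ), IsComputableRatSeq r ∧ Computable ξ ∧
    ∀ M n : ℕ, ξ M ≤ n → |x - (r n : ℝ)| ≤ ((2 : ℝ) ^ M)⁻¹

/-! ### Machine-readable descriptions

A description is a finite tuple of programs (codes of partial recursive functions).
Functions of several natural numbers are computed through the pairing function. -/

/-- The program `e` computes the total function `g`. -/
def ProgramComputes (e : Nat.Partrec.Code) (g : ℕ → ℕ) : Prop :=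
  ∀ n, e.eval n = Part.some (g n)

/-- Programs for sign, numerator and denominator of a sequence of rational numbers. -/
abbrev RatSeqCode : Type := Nat.Partrec.Code × Nat.Partrec.Code × Nat.Partrec.Code

def RatSeqCode.Describes (q : RatSeqCode) (r : ℕ → ℚ) : Prop :=
  ∃ s a b : ℕ → ℕ, ProgramComputes q.1 s ∧ ProgramComputes q.2.1 a ∧ ProgramComputes q.2.2 b ∧
    ∀ n, b n ≠ 0 ∧ r n = (-1) ^ s n * (a n : ℚ) / (b n : ℚ)

/-- Programs for a double sequence of rational numbers and for a modulus of convergence; uniformly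
in `i`, this gives a standard description of the `i`-th member of a sequence of real numbers. -/
abbrev RealSeqCode : Type := RatSeqCode × Nat.Partrec.Code

def RealSeqCode.Describes (d : RealSeqCode) (x : ℕ → ℝ) : Prop :=
  ∃ (r : ℕ → ℚ) (ξ : ℕ → ℕ), RatSeqCode.Describes d.1 r ∧ ProgramComputes d.2 ξ ∧
    ∀ i M j : ℕ, ξ (Nat.pair i M) ≤ j → |x i - (r (Nat.pair i j) : ℝ)| ≤ ((2 : ℝ) ^ M)⁻¹

/-- Descriptions of the real and of the imaginary parts of a sequence of complex numbers. -/
abbrev ComplexSeqCode : Type := RealSeqCode × RealSeqCode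

def ComplexSeqCode.Describes (d : ComplexSeqCode) (c : ℕ → ℂ) : Prop :=
  RealSeqCode.Describes d.1 (fun i => (c i).re) ∧ RealSeqCode.Describes d.2 (fun i => (c i).im)

/-- A program for the half-lengths `L n`, and a description of the double sequence `c n j` whose
members with `j ≤ 2 * L n` are the entries of the `n`-th tuple. -/
abbrev TupleSeqCode : Type := Nat.Partrec.Code × ComplexSeqCode

def TupleSeqCode.Describes (d : TupleSeqCode) (L : ℕ → ℕ) (c : ℕ → ℕ → ℂ) : Prop :=
  ProgramComputes d.1 L ∧ ComplexSeqCode.Describes d.2 (fun i => c i.unpair.1 i.unpair.2)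

/-- `d` describes the computable sequence `x 0, x 1, …` of elementary computable sequences. -/
def TupleSeqCode.DescribesSeqs (d : TupleSeqCode) (x : ℕ → ℤ → ℂ) : Prop :=
  ∃ (L : ℕ → ℕ) (c : ℕ → ℕ → ℂ), TupleSeqCode.Describes d L c ∧ ∀ n, x n = finiteSeq (L n) (c n)

/-- `d` describes the computable sequence `f 0, f 1, …` of elementary computable functions. -/
def TupleSeqCode.DescribesFuns (d : TupleSeqCode) (f : ℕ → ℂ → ℂ) : Prop :=
  ∃ (L : ℕ → ℕ) (c : ℕ → ℕ → ℂ), TupleSeqCode.Describes d L c ∧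
    ∀ n, f n = finiteSamplingSeries (L n) (c n)

/-- A pair consisting of a description of the approximating sequence and of a program for the
modulus of convergence. The same data format serves for discrete-time and for continuous-time
descriptions. -/
abbrev SignalCode : Type := TupleSeqCode × Nat.Partrec.Code

/-- `X = (⟨x_n⟩, ξ')` is a discrete-time description of `x ∈ ℓ^p`. -/
def IsDiscreteTimeDescription (p : ℝ) (X : SignalCode) (x : ℤ → ℂ) : Prop :=
  x ∈ ellSpace p ∧
    ∃ (xs : ℕ → ℤ → ℂ) (ξ : ℕ → ℕ), TupleSeqCode.DescribesSeqs X.1 xs ∧ ProgramComputes X.2 ξ ∧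
      ∀ M n : ℕ, ξ M ≤ n → ellNorm p (x - xs n) ≤ ((2 : ℝ≥0∞) ^ M)⁻¹

/-- `F = (⟨f_n⟩, ξ)` is a continuous-time description of `f ∈ B_π^p`. -/
def IsContinuousTimeDescription (p : ℝ) (F : SignalCode) (f : ℂ → ℂ) : Prop :=
  f ∈ bernsteinSpace Real.pi p ∧
    ∃ (fs : ℕ → ℂ → ℂ) (ξ : ℕ → ℕ), TupleSeqCode.DescribesFuns F.1 fs ∧ ProgramComputes F.2 ξ ∧
      ∀ M n : ℕ, ξ M ≤ n → bernsteinNorm p (f - fs n) ≤ ((2 : ℝ≥0∞) ^ M)⁻¹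

/-! ### Computability of the interpolation operator -/

/-- The algorithm `Φ` computes the interpolation operator, i.e. the inverse of the sampling operator
on its image. It turns every discrete-time description into a continuous-time description and,
whenever the described sequence consists of the samples of a signal `f ∈ B_π^p`, the output is a
description of `f`. -/
def ComputesInterpolation (p : ℝ) (Φ : SignalCode →. SignalCode) : Prop :=
  Partrec Φ ∧
    ∀ (X : SignalCode) (x : ℤ → ℂ), IsDiscreteTimeDescription p X x →
      ∃ F ∈ Φ X, (∃ g, IsContinuousTimeDescription p F g) ∧
        ∀ f ∈ bernsteinSpace Real.pi p, sampling f = x → IsContinuousTimeDescription p F f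

/-- The interpolation operator on `img(S_p)` is computable. -/
def InterpolationComputable (p : ℝ) : Prop :=
  ∃ Φ : SignalCode →. SignalCode, ComputesInterpolation p Φ

/-! ### The Cauchy kernel and its conjugate -/

/-! The machine copies the coefficient programs and delays the modulus by a fixed natural number
`K`. A tuple read as a sequence `x_n` and the same tuple read as a sampling series `f_n` are related
by `f_n = T_p x_n`, so only the modulus changes. Since `f - f_n` lies in the Bernstein space and has
samples `x - x_n`, the right-hand Plancherel-Pólya inequality gives `‖f - f_n‖ ≤ C ^ (1/p) ‖x - x_n‖
≤ 2 ^ K ‖x - x_n‖` with `K = ⌈log₂ C⌉₊`. The number `K` is built into the program.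

The analytic work is the existence of such a `C` for every `p > 1`, together with the fact that
every `ℓ^p` sequence has exactly one interpolant.

Existence of `C`: on the real line `sinc (t - k)` is `± sin (π t) / π` times the conjugate Cauchy
kernel `t / (1 + t²)` at `t - k`, plus an error dominated by the Cauchy kernel
(`csinc_sub_intCast_eq`). Schur's test handles the error. The main term is a Hilbert transform in
disguise (`conjCauchyBound`). For `1 < p ≤ 2` the classical complex proof of M. Riesz' inequality
applies: for nonnegative coefficients, `F z = ∑ a k * i / (z - k)` maps the upper half-plane to the
right half-plane, the integral of `F ^ p` over `Im z = 1` vanishes by Cauchy's theorem, and an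
elementary inequality bounds `|F| ^ p` by `(Re F) ^ p` up to a multiple of `Re (F ^ p)`. For `p ≥ 2`
the bound is discretised, dualised and made continuous again.

Interpolants: Hölder's inequality makes the Shannon series converge uniformly on horizontal strips,
and Fatou's lemma carries the finite estimate over to it. For uniqueness
(`eq_zero_of_sampling_eq_zero`), a signal vanishing at the integers is divided by `sin (π z)`;
Phragmén-Lindelöf and the maximum principle bound the quotient, Liouville makes it constant, and
decay along the real line makes it zero. -/

/-- The Cauchy (Poisson) kernel `1 / (1 + t²)`. -/
noncomputable def cauchyKer (t : ℝ) : ℝ := (1 + t ^ 2)⁻¹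

/-- The conjugate Cauchy kernel `t / (1 + t²)`. -/
noncomputable def conjCauchyKer (t : ℝ) : ℝ := t * (1 + t ^ 2)⁻¹

lemma cauchyKer_pos (t : ℝ) : 0 < cauchyKer t := by unfold cauchyKer; positivity

lemma cauchyKer_le_of_abs_sub_le {s t : ℝ} (h : |s - t| ≤ 1) : cauchyKer s ≤ 3 * cauchyKer t := by
  unfold cauchyKer
  have h2 : (s - t) ^ 2 ≤ 1 := by
    rw [← sq_abs]; nlinarith [abs_nonneg (s - t)]
  rw [← div_eq_mul_inv, inv_eq_one_div, div_le_div_iff₀ (by positivity) (by positivity)]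
  nlinarith [sq_nonneg (2 * s - t)]

/-- The difference factors as `(s - t)(1 - s t)` times both Cauchy kernels, and `(1 - s t)² ≤ (1 +
s²)(1 + t²)`. Thus replacing `t` by `⌊t⌋` in the conjugate kernel costs only a term accessible to
Schur's test. -/
lemma abs_conjCauchyKer_sub_le {s t : ℝ} (h : |s - t| ≤ 1) :
    |conjCauchyKer s - conjCauchyKer t| ≤ 3 * cauchyKer t := by
  have hP := cauchyKer_le_of_abs_sub_le h
  have key : conjCauchyKer s - conjCauchyKer t
      = (s - t) * ((1 - s * t) * (cauchyKer s * cauchyKer t)) := by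
    unfold conjCauchyKer cauchyKer; field_simp; ring
  have hs := cauchyKer_pos s
  have ht := cauchyKer_pos t
  have h1 : ((1 - s * t) * (cauchyKer s * cauchyKer t)) ^ 2 ≤ cauchyKer s * cauchyKer t := by
    have e : cauchyKer s * cauchyKer t * ((1 + s ^ 2) * (1 + t ^ 2)) = 1 := by
      unfold cauchyKer; field_simp
    have : (1 - s * t) ^ 2 ≤ (1 + s ^ 2) * (1 + t ^ 2) := by nlinarith [sq_nonneg (s + t)]
    calc _ = (1 - s * t) ^ 2 * (cauchyKer s * cauchyKer t) ^ 2 := by ring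
      _ ≤ ((1 + s ^ 2) * (1 + t ^ 2)) * (cauchyKer s * cauchyKer t) ^ 2 := by gcongr
      _ = (cauchyKer s * cauchyKer t * ((1 + s ^ 2) * (1 + t ^ 2))) *
            (cauchyKer s * cauchyKer t) := by ring
      _ = _ := by rw [e, one_mul]
  rw [key, abs_mul]
  have h3 : |(1 - s * t) * (cauchyKer s * cauchyKer t)| ≤ 3 * cauchyKer t := by
    apply abs_le_of_sq_le_sq _ (by positivity)
    nlinarith
  calc _ ≤ 1 * |(1 - s * t) * (cauchyKer s * cauchyKer t)| := by gcongr
    _ ≤ _ := by rw [one_mul]; exact h3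

lemma abs_sub_floor_le_one (t : ℝ) : |t - (⌊t⌋ : ℤ)| ≤ 1 := by
  have h1 := Int.floor_le t
  have h2 := Int.lt_floor_add_one t
  rw [abs_le]; constructor <;> linarith

lemma summable_cauchyKer_rpow {r : ℝ} (hr : 1 < r) :
    Summable fun m : ℤ => cauchyKer (m : ℝ) ^ (r / 2) := by
  -- The comparison with `|m| ^ (-r)` fails at `m = 0`; this summand covers that index.
  have h0 : Summable fun m : ℤ => if m = 0 then (1 : ℝ) else 0 :=
    summable_of_ne_finset_zero (s := {0}) (by intro b hb; simp at hb; simp [hb])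
  refine Summable.of_nonneg_of_le (fun m => by have := cauchyKer_pos (m : ℝ); positivity) ?_
    ((Real.summable_abs_int_rpow hr).add h0)
  intro m
  by_cases hm : m = 0
  · subst hm
    have : (0 : ℝ) ≤ 0 ^ (-r) := by positivity
    simp [cauchyKer, this]
  · have hm' : (0 : ℝ) < |(m : ℝ)| := by simpa using hm
    simp only [hm, if_false, add_zero]
    have : |(m : ℝ)| ^ (-r) = (((m : ℝ) ^ 2)⁻¹) ^ (r / 2) := by
      rw [← sq_abs, Real.inv_rpow (by positivity), ← Real.rpow_natCast, ← Real.rpow_mul hm'.le,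
        Real.rpow_neg hm'.le]
      congr 2; push_cast; ring
    rw [this]
    unfold cauchyKer
    have hm2 : (0 : ℝ) < (m : ℝ) ^ 2 := by rw [← sq_abs]; positivity
    gcongr
    linarith

/-- Moving `t` to `⌊t⌋` costs a factor 3 per kernel and leaves a sum over the integers independent
of `t`. -/
lemma exists_tsum_cauchyKer_rpow_le {r : ℝ} (hr : 1 < r) :
    ∃ M : ℝ≥0∞, M ≠ ∞ ∧ ∀ t : ℝ,
      ∑' k : ℤ, ENNReal.ofReal (cauchyKer (t - k)) ^ (r / 2) ≤ M := by
  refine ⟨∑' m : ℤ, 3 ^ (r / 2) * ENNReal.ofReal (cauchyKer m) ^ (r / 2), ?_, fun t => ?_⟩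
  · rw [ENNReal.tsum_mul_left]
    refine ENNReal.mul_ne_top (ENNReal.rpow_ne_top_of_nonneg (by linarith) (by simp)) ?_
    have : ∀ m : ℤ, ENNReal.ofReal (cauchyKer m) ^ (r / 2)
        = ENNReal.ofReal (cauchyKer m ^ (r / 2)) := fun m =>
      ENNReal.ofReal_rpow_of_nonneg (cauchyKer_pos _).le (by linarith)
    simp_rw [this]
    exact (summable_cauchyKer_rpow hr).tsum_ofReal_ne_top
  · rw [← (Equiv.subLeft ⌊t⌋).tsum_eq]
    refine ENNReal.tsum_le_tsum fun m => ?_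
    rw [← ENNReal.mul_rpow_of_nonneg _ _ (by linarith)]
    refine ENNReal.rpow_le_rpow ?_ (by linarith)
    rw [show (3 : ℝ≥0∞) = ENNReal.ofReal 3 by simp, ← ENNReal.ofReal_mul (by norm_num)]
    apply ENNReal.ofReal_le_ofReal
    apply cauchyKer_le_of_abs_sub_le
    convert abs_sub_floor_le_one t using 2
    simp only [Equiv.subLeft_apply]; push_cast; ring

/-- Schur's test for kernels with discrete second variable. -/
lemma lintegral_sum_mul_rpow_le {α ι : Type*} [MeasurableSpace α] {μ : Measure α} {p : ℝ}
    (hp : 1 ≤ p) {K : α → ι → ℝ≥0∞} (hK : ∀ k, Measurable fun t => K t k) {M N : ℝ≥0∞}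
    (S : Finset ι) (hM : ∀ t, ∑ k ∈ S, K t k ≤ M) (hN : ∀ k, ∫⁻ t, K t k ∂μ ≤ N)
    (a : ι → ℝ≥0∞) :
    ∫⁻ t, (∑ k ∈ S, K t k * a k) ^ p ∂μ ≤ M ^ (p - 1) * N * ∑ k ∈ S, a k ^ p := by
  have hp0 : 0 < p := by linarith
  calc ∫⁻ t, (∑ k ∈ S, K t k * a k) ^ p ∂μ
      ≤ ∫⁻ t, M ^ (p - 1) * ∑ k ∈ S, K t k * a k ^ p ∂μ := by
        refine lintegral_mono fun t => ?_
        -- Hölder with weights `K t k`: `(∑ K a) ^ p ≤ (∑ K) ^ (p - 1) * ∑ K a ^ p`.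
        have h := ENNReal.rpow_le_rpow
          (ENNReal.inner_le_weight_mul_Lp_of_nonneg S hp (K t) a) hp0.le
        refine h.trans ?_
        rw [ENNReal.mul_rpow_of_nonneg _ _ hp0.le, ← ENNReal.rpow_mul, ← ENNReal.rpow_mul,
          inv_mul_cancel₀ hp0.ne', ENNReal.rpow_one, sub_mul, inv_mul_cancel₀ hp0.ne', one_mul]
        gcongr
        exact hM t
    _ = M ^ (p - 1) * ∑ k ∈ S, (∫⁻ t, K t k ∂μ) * a k ^ p := by
        rw [lintegral_const_mul _ (by fun_prop), lintegral_finsetSum _ (by fun_prop)]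
        congr 1
        refine Finset.sum_congr rfl fun k _ => ?_
        rw [lintegral_mul_const _ (hK k)]
    _ ≤ M ^ (p - 1) * ∑ k ∈ S, N * a k ^ p := by
        gcongr with k
        exact hN k
    _ = _ := by rw [← Finset.mul_sum, mul_assoc]

lemma exists_lintegral_sum_cauchyKer_rpow_le {p : ℝ} (hp : 1 ≤ p) :
    ∃ C : ℝ≥0∞, C ≠ ∞ ∧ ∀ (S : Finset ℤ) (a : ℤ → ℝ≥0∞),
      ∫⁻ t : ℝ, (∑ k ∈ S, ENNReal.ofReal (cauchyKer (t - k)) * a k) ^ p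
        ≤ C * ∑ k ∈ S, a k ^ p := by
  obtain ⟨M, hM, hMb⟩ := exists_tsum_cauchyKer_rpow_le (r := 2) (by norm_num)
  refine ⟨M ^ (p - 1) * ∫⁻ t : ℝ, ENNReal.ofReal (cauchyKer t), ?_, fun S a => ?_⟩
  · refine ENNReal.mul_ne_top (ENNReal.rpow_ne_top_of_nonneg (by linarith) hM) ?_
    exact integrable_inv_one_add_sq.lintegral_lt_top.ne
  · apply lintegral_sum_mul_rpow_le hp
    · intro k; unfold cauchyKer; fun_prop
    · intro t
      refine le_trans ?_ (hMb t)
      refine le_trans (le_of_eq ?_) (ENNReal.sum_le_tsum S)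
      simp
    · intro k
      rw [lintegral_sub_right_eq_self (fun t => ENNReal.ofReal (cauchyKer t)) (k : ℝ)]

/-- Sums over the integers as integrals of step functions. -/
lemma lintegral_floor (h : ℤ → ℝ≥0∞) : ∫⁻ t : ℝ, h ⌊t⌋ = ∑' n : ℤ, h n := by
  rw [← setLIntegral_univ, ← iUnion_Ico_intCast ℝ, lintegral_iUnion (fun _ => measurableSet_Ico)
    (Set.pairwise_disjoint_Ico_intCast ℝ)]
  refine tsum_congr fun n => ?_
  rw [setLIntegral_congr_fun (g := fun _ => h n) measurableSet_Ico
    (fun t ht => by rw [Int.floor_eq_on_Ico n t ht])]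
  simp

/-! ### M. Riesz' inequality for the conjugate Cauchy kernel -/

/-- With `φ = arg w`: if `|φ|` is close to `π / 2`, then `p |φ|` lies beyond `π / 2` but, as `p ≤
2`, not beyond `π`, so `cos (p φ)` is negative and bounded away from zero. For all other `φ`, `cos
φ` is bounded below. -/
lemma exists_norm_rpow_le_re {p : ℝ} (hp : 1 < p) (hp2 : p ≤ 2) :
    ∃ A B : ℝ, 0 ≤ A ∧ 0 ≤ B ∧ ∀ w : ℂ, 0 < w.re →
      ‖w‖ ^ p ≤ A * w.re ^ p - B * (w ^ (p : ℂ)).re := by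
  have hp0 : 0 < p := by linarith
  have hπ := Real.pi_pos
  -- Chosen so that `p θ` is the midpoint of `π / 2` and `p π / 2`.
  set θ : ℝ := Real.pi * (1 + p) / (4 * p) with hθ
  have hpθ : p * θ = Real.pi * (1 + p) / 4 := by rw [hθ]; field_simp
  have hθ0 : 0 < θ := by rw [hθ]; positivity
  have hθ1 : θ < Real.pi / 2 := by
    rw [hθ, div_lt_div_iff₀ (by positivity) (by positivity)]; nlinarith
  have hc : Real.cos (p * θ) < 0 := by
    apply Real.cos_neg_of_pi_div_two_lt_of_lt <;> rw [hpθ] <;> nlinarith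
  set c : ℝ := -Real.cos (p * θ) with hcdef
  have hc0 : 0 < c := by linarith
  have hd : 0 < Real.cos θ := Real.cos_pos_of_mem_Ioo ⟨by linarith, hθ1⟩
  refine ⟨(1 + c⁻¹) * (Real.cos θ ^ p)⁻¹, c⁻¹, by positivity, by positivity, fun w hw => ?_⟩
  have harg : |w.arg| < Real.pi / 2 := Complex.abs_arg_lt_pi_div_two_iff.2 (Or.inl hw)
  have hre : w.re = ‖w‖ * Real.cos |w.arg| := by rw [Real.cos_abs, Complex.norm_mul_cos_arg]
  have hcp : (w ^ (p : ℂ)).re = ‖w‖ ^ p * Real.cos (p * |w.arg|) := by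
    rw [Complex.cpow_ofReal_re, ← Real.cos_abs, abs_mul, abs_of_pos hp0, mul_comm p]
  have hcos : 0 < Real.cos |w.arg| :=
    Real.cos_pos_of_mem_Ioo ⟨by linarith [abs_nonneg w.arg], harg⟩
  rw [hcp, hre, Real.mul_rpow (norm_nonneg _) hcos.le]
  suffices h : 1 ≤ (1 + c⁻¹) * (Real.cos θ ^ p)⁻¹ * Real.cos |w.arg| ^ p
      - c⁻¹ * Real.cos (p * |w.arg|) by
    have := mul_le_mul_of_nonneg_left h (Real.rpow_nonneg (norm_nonneg w) p)
    linarith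
  rcases le_total θ |w.arg| with h | h
  · have h1 : Real.cos (p * |w.arg|) ≤ -c := by
      rw [hcdef, neg_neg]
      apply Real.cos_le_cos_of_nonneg_of_le_pi (by positivity)
      · nlinarith [abs_nonneg w.arg]
      · gcongr
    have h2 : c⁻¹ * Real.cos (p * |w.arg|) ≤ -1 := by
      calc _ ≤ c⁻¹ * -c := by gcongr
        _ = -1 := by field_simp
    have : 0 ≤ (1 + c⁻¹) * (Real.cos θ ^ p)⁻¹ * Real.cos |w.arg| ^ p := by positivity
    linarith
  · have h1 : Real.cos θ ≤ Real.cos |w.arg| :=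
      Real.cos_le_cos_of_nonneg_of_le_pi (abs_nonneg _) (by linarith) h
    have h2 : 1 + c⁻¹ ≤ (1 + c⁻¹) * (Real.cos θ ^ p)⁻¹ * Real.cos |w.arg| ^ p := by
      rw [mul_assoc]
      apply le_mul_of_one_le_right (by positivity)
      rw [inv_mul_eq_div, one_le_div (by positivity)]
      gcongr
    have h3 : c⁻¹ * Real.cos (p * |w.arg|) ≤ c⁻¹ * 1 := by gcongr; exact Real.cos_le_one _
    linarith

/-- The integral over a horizontal line of a holomorphic function that decays in the half-plane
above it vanishes. -/
lemma integral_add_I_eq_zero {G : ℂ → ℂ} {p C R₀ : ℝ} (hp : 1 < p)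
    (hG : DifferentiableOn ℂ G {z | 0 < z.im})
    (hC : ∀ z : ℂ, 1 ≤ z.im → R₀ ≤ ‖z‖ → ‖G z‖ ≤ C * ‖z‖ ^ (-p))
    (hint : Integrable fun t : ℝ => G (t + Complex.I)) :
    ∫ t : ℝ, G (t + Complex.I) = 0 := by
  have hlim := intervalIntegral_tendsto_integral hint tendsto_neg_atTop_atBot
    (tendsto_id (α := ℝ) (x := atTop))
  refine tendsto_nhds_unique hlim ?_
  have hdecay : Tendsto (fun R : ℝ => 4 * |C| * R ^ (-(p - 1))) atTop (𝓝 0) := by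
    simpa using (tendsto_rpow_neg_atTop (by linarith : 0 < p - 1)).const_mul (4 * |C|)
  refine squeeze_zero_norm' ?_ hdecay
  filter_upwards [eventually_ge_atTop R₀, eventually_ge_atTop 1] with R hR hR1
  have hR0 : 0 < R := by linarith
  -- On the rectangle from `-R + i` to `R + (1 + R) i` the three other sides have total length `4
  -- R`, and `G` is `O(R ^ (-p))` there.
  have key := Complex.integral_boundary_rect_eq_zero_of_differentiableOn G
    (⟨-R, 1⟩ : ℂ) (⟨R, 1 + R⟩ : ℂ) (hG.mono (by
      intro z hz
      have := hz.2
      simp only [Set.mem_preimage] at this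
      rw [Set.uIcc_of_le (by linarith)] at this
      have := this.1
      show 0 < z.im
      linarith))
  simp only [Complex.ofReal_one, one_mul] at key
  have hb : ∀ z : ℂ, 1 ≤ z.im → R ≤ ‖z‖ → ‖G z‖ ≤ |C| * R ^ (-p) := fun z h1 h2 => by
    refine (hC z h1 (hR.trans h2)).trans ?_
    calc C * ‖z‖ ^ (-p) ≤ |C| * ‖z‖ ^ (-p) := by gcongr; exact le_abs_self C
      _ ≤ _ := by
        gcongr ?_ * ?_
        exact Real.rpow_le_rpow_of_nonpos hR0 h2 (by linarith)
  have hs : ∀ z : ℂ, R ≤ |z.re| → R ≤ ‖z‖ := fun z h => h.trans (Complex.abs_re_le_norm z)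
  have h1 : ‖∫ x : ℝ in -R..R, G (x + ((1 + R : ℝ) : ℂ) * Complex.I)‖
      ≤ |C| * R ^ (-p) * |R - -R| := by
    apply intervalIntegral.norm_integral_le_of_norm_le_const
    intro x _
    apply hb
    · simp; linarith
    · refine le_trans ?_ (Complex.abs_im_le_norm _)
      simp only [Complex.add_im, Complex.ofReal_im, Complex.mul_im, Complex.ofReal_re,
        Complex.I_im, Complex.I_re, mul_one, mul_zero, add_zero, zero_add]
      exact le_trans (by linarith) (le_abs_self _)
  have h2 : ∀ s : ℝ, |s| = R → ‖∫ y : ℝ in (1 : ℝ)..(1 + R), G (s + y * Complex.I)‖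
      ≤ |C| * R ^ (-p) * |1 + R - 1| := by
    intro s hsR
    apply intervalIntegral.norm_integral_le_of_norm_le_const
    intro y hy
    rw [Set.uIoc_of_le (by linarith)] at hy
    apply hb
    · simpa using hy.1.le
    · apply hs; simp [hsR]
  have h3 := h2 R (abs_of_pos hR0)
  have h4 := h2 (-R) (by rw [abs_neg, abs_of_pos hR0])
  have e : ∫ x : ℝ in -R..R, G (x + Complex.I)
      = (∫ x : ℝ in -R..R, G (x + ((1 + R : ℝ) : ℂ) * Complex.I))
        - Complex.I • (∫ y : ℝ in (1 : ℝ)..(1 + R), G ((R : ℝ) + y * Complex.I))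
        + Complex.I • (∫ y : ℝ in (1 : ℝ)..(1 + R), G (((-R : ℝ) : ℂ) + y * Complex.I)) := by
    linear_combination key
  have hRp : R ^ (-(p - 1)) = R ^ (-p) * R := by
    rw [show -(p - 1) = -p + 1 by ring, Real.rpow_add hR0, Real.rpow_one]
  simp only [id]
  rw [e, hRp]
  have n1 := norm_add_le ((∫ x : ℝ in -R..R, G (x + ((1 + R : ℝ) : ℂ) * Complex.I))
        - Complex.I • (∫ y : ℝ in (1 : ℝ)..(1 + R), G ((R : ℝ) + y * Complex.I)))
        (Complex.I • (∫ y : ℝ in (1 : ℝ)..(1 + R), G (((-R : ℝ) : ℂ) + y * Complex.I)))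
  have n2 := norm_sub_le (∫ x : ℝ in -R..R, G (x + ((1 + R : ℝ) : ℂ) * Complex.I))
        (Complex.I • (∫ y : ℝ in (1 : ℝ)..(1 + R), G ((R : ℝ) + y * Complex.I)))
  rw [norm_smul, Complex.norm_I, one_mul] at n1 n2
  have a1 : |R - -R| = 2 * R := by rw [abs_of_pos] <;> linarith
  have a2 : |1 + R - 1| = R := by rw [abs_of_pos] <;> linarith
  rw [a1] at h1
  rw [a2] at h3 h4
  linarith

/-- The sum of simple fractions `∑ a k * i / (z - k)`. -/
noncomputable def cauchySum (S : Finset ℤ) (a : ℤ → ℝ) (z : ℂ) : ℂ :=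
  ∑ k ∈ S, (a k : ℂ) * (Complex.I / (z - k))

lemma sub_intCast_ne_zero {z : ℂ} (hz : 0 < z.im) (k : ℤ) : z - k ≠ 0 := by
  intro h
  have := congrArg Complex.im h
  simp at this
  linarith

lemma re_I_div_sub_intCast (z : ℂ) (k : ℤ) :
    (Complex.I / (z - k)).re = z.im / Complex.normSq (z - k) := by
  simp [Complex.div_re]

/-- Values in the right half-plane avoid the branch cut, so the principal power `cauchySum ^ p` is
holomorphic. -/
lemma cauchySum_re_pos {S : Finset ℤ} {a : ℤ → ℝ} (ha : ∀ k, 0 ≤ a k) (hS : ∃ k ∈ S, 0 < a k)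
    {z : ℂ} (hz : 0 < z.im) : 0 < (cauchySum S a z).re := by
  unfold cauchySum
  rw [Complex.re_sum]
  have h : ∀ k : ℤ, 0 < (Complex.I / (z - k)).re := fun k => by
    rw [re_I_div_sub_intCast]
    exact div_pos hz (Complex.normSq_pos.2 (sub_intCast_ne_zero hz k))
  simp_rw [Complex.re_ofReal_mul]
  obtain ⟨k, hk, hk0⟩ := hS
  exact Finset.sum_pos' (fun k _ => mul_nonneg (ha k) (h k).le) ⟨k, hk, mul_pos hk0 (h k)⟩

/-- At height one the simple fraction has the Cauchy kernel as real part and its conjugate as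
imaginary part. -/
lemma I_div_add_I (t : ℝ) (k : ℤ) :
    Complex.I / ((t : ℂ) + Complex.I - k)
      = (cauchyKer (t - k) : ℂ) + (conjCauchyKer (t - k) : ℂ) * Complex.I := by
  have h0 : (t : ℂ) + Complex.I - k ≠ 0 := sub_intCast_ne_zero (by simp) k
  have h1 : (1 + ((t : ℂ) - k) ^ 2) ≠ 0 := by
    have : (1 + (t - k) ^ 2 : ℝ) ≠ 0 := by positivity
    exact_mod_cast this
  unfold cauchyKer conjCauchyKer
  push_cast
  rw [div_eq_iff h0]
  field_simp
  linear_combination (-(t : ℂ) + k) * Complex.I_sq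

lemma cauchySum_add_I (S : Finset ℤ) (a : ℤ → ℝ) (t : ℝ) :
    cauchySum S a (t + Complex.I)
      = ((∑ k ∈ S, a k * cauchyKer (t - k) : ℝ) : ℂ)
        + ((∑ k ∈ S, a k * conjCauchyKer (t - k) : ℝ) : ℂ) * Complex.I := by
  unfold cauchySum
  simp_rw [I_div_add_I]
  push_cast
  rw [Finset.sum_mul, ← Finset.sum_add_distrib]
  exact Finset.sum_congr rfl fun k _ => by ring

lemma differentiableOn_cauchySum (S : Finset ℤ) (a : ℤ → ℝ) :
    DifferentiableOn ℂ (cauchySum S a) {z | 0 < z.im} := by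
  unfold cauchySum
  refine DifferentiableOn.fun_sum fun k _ => ?_
  refine DifferentiableOn.const_mul ?_ _
  refine (differentiableOn_const _).div (by fun_prop) fun z hz => sub_intCast_ne_zero hz k

lemma exists_norm_cauchySum_le (S : Finset ℤ) (a : ℤ → ℝ) :
    ∃ C R₀ : ℝ, 0 ≤ C ∧ ∀ z : ℂ, R₀ ≤ ‖z‖ → ‖cauchySum S a z‖ ≤ C * ‖z‖⁻¹ := by
  refine ⟨∑ k ∈ S, |a k| * 2, 1 + ∑ k ∈ S, 2 * |(k : ℝ)|, by positivity, fun z hz => ?_⟩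
  unfold cauchySum
  rw [Finset.sum_mul]
  refine (norm_sum_le _ _).trans (Finset.sum_le_sum fun k hk => ?_)
  have hk2 : 2 * |(k : ℝ)| ≤ ∑ k ∈ S, 2 * |(k : ℝ)| :=
    Finset.single_le_sum (f := fun k : ℤ => 2 * |(k : ℝ)|) (fun _ _ => by positivity) hk
  have hz0 : 0 < ‖z‖ := by linarith [abs_nonneg (k : ℝ)]
  have h1 : ‖z‖ / 2 ≤ ‖z - k‖ := by
    have := norm_sub_norm_le z (k : ℂ)
    rw [Complex.norm_intCast] at this
    linarith
  rw [norm_mul, Complex.norm_real, norm_div, Complex.norm_I, mul_assoc, Real.norm_eq_abs]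
  gcongr
  calc 1 / ‖z - k‖ ≤ 1 / (‖z‖ / 2) := by gcongr
    _ = _ := by field_simp

lemma memLp_cauchySum (S : Finset ℤ) (a : ℤ → ℝ) {p : ℝ} (hp : 1 < p) :
    MemLp (fun t : ℝ => cauchySum S a (t + Complex.I)) (ENNReal.ofReal p) := by
  unfold cauchySum
  refine memLp_finsetSum S fun k _ => ?_
  refine MemLp.const_mul ?_ _
  have hp0 : 0 < p := by linarith
  have hcont : Continuous fun t : ℝ => Complex.I / ((t : ℂ) + Complex.I - k) :=
    continuous_const.div (by fun_prop) fun t => sub_intCast_ne_zero (by simp) k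
  rw [← integrable_norm_rpow_iff hcont.aestronglyMeasurable (by simpa using hp0) (by simp),
    ENNReal.toReal_ofReal hp0.le]
  have h := (integrable_rpow_neg_one_add_norm_sq (E := ℝ) (μ := volume) (r := p)
    (by simpa using hp)).comp_sub_right (k : ℝ)
  refine h.congr (Eventually.of_forall fun t => ?_)
  have e : ‖(t : ℂ) + Complex.I - k‖ = (1 + ‖t - k‖ ^ 2) ^ (1 / 2 : ℝ) := by
    rw [← Real.sqrt_eq_rpow, Complex.norm_def, Complex.normSq_apply]
    congr 1
    simp; ring
  simp only [norm_div, Complex.norm_I, e]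
  rw [one_div, ← Real.rpow_neg (by positivity), ← Real.rpow_mul (by positivity)]
  congr 1; ring

lemma continuous_cauchySum_add_I (S : Finset ℤ) (a : ℤ → ℝ) :
    Continuous fun t : ℝ => cauchySum S a (t + Complex.I) :=
  (differentiableOn_cauchySum S a).continuousOn.comp_continuous (by fun_prop) fun t => by simp

lemma integrable_norm_cauchySum_rpow (S : Finset ℤ) (a : ℤ → ℝ) {p : ℝ} (hp : 1 < p) :
    Integrable fun t : ℝ => ‖cauchySum S a (t + Complex.I)‖ ^ p := by
  have hp0 : 0 < p := by linarith
  simpa [ENNReal.toReal_ofReal hp0.le] using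
    (memLp_cauchySum S a hp).integrable_norm_rpow (by simpa using hp0) (by simp)

lemma integrable_cauchySum_re_rpow {p : ℝ} (hp : 1 < p) {S : Finset ℤ} {a : ℤ → ℝ}
    (ha : ∀ k, 0 ≤ a k) (hS : ∃ k ∈ S, 0 < a k) :
    Integrable fun t : ℝ => (cauchySum S a (t + Complex.I)).re ^ p := by
  have hp0 : 0 < p := by linarith
  have hposI : ∀ t : ℝ, 0 < (cauchySum S a (t + Complex.I)).re := fun t =>
    cauchySum_re_pos ha hS (by simp)
  refine (integrable_norm_cauchySum_rpow S a hp).mono' ?_ (Eventually.of_forall fun t => ?_)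
  · exact ((Complex.continuous_re.comp (continuous_cauchySum_add_I S a)).rpow_const
      fun t => Or.inr hp0.le).aestronglyMeasurable
  · rw [Real.norm_of_nonneg (Real.rpow_nonneg (hposI t).le _)]
    exact Real.rpow_le_rpow (hposI t).le (Complex.re_le_norm _) hp0.le

/-- Integrate the pointwise inequality: the `B`-term drops out, because the `p`-th power of the sum
is `O(‖z‖ ^ (-p))` and its integral over the line vanishes. -/
lemma integral_norm_cauchySum_rpow_le {p A B : ℝ} (hp : 1 < p)
    (hAB : ∀ w : ℂ, 0 < w.re → ‖w‖ ^ p ≤ A * w.re ^ p - B * (w ^ (p : ℂ)).re)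
    {S : Finset ℤ} {a : ℤ → ℝ} (ha : ∀ k, 0 ≤ a k) (hS : ∃ k ∈ S, 0 < a k) :
    ∫ t : ℝ, ‖cauchySum S a (t + Complex.I)‖ ^ p
      ≤ A * ∫ t : ℝ, (cauchySum S a (t + Complex.I)).re ^ p := by
  have hp0 : 0 < p := by linarith
  have hpos : ∀ z : ℂ, 0 < z.im → 0 < (cauchySum S a z).re := fun z hz =>
    cauchySum_re_pos ha hS hz
  have hposI : ∀ t : ℝ, 0 < (cauchySum S a (t + Complex.I)).re := fun t => hpos _ (by simp)
  have hcont := continuous_cauchySum_add_I S a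
  have hn := integrable_norm_cauchySum_rpow S a hp
  have hcp : Continuous fun t : ℝ => cauchySum S a (t + Complex.I) ^ (p : ℂ) :=
    hcont.cpow continuous_const fun t => Or.inl (hposI t)
  have hi : Integrable fun t : ℝ => cauchySum S a (t + Complex.I) ^ (p : ℂ) := by
    rw [← integrable_norm_iff hcp.aestronglyMeasurable]
    simpa only [Complex.norm_cpow_real] using hn
  have hr := integrable_cauchySum_re_rpow hp ha hS
  have hzero : ∫ t : ℝ, cauchySum S a (t + Complex.I) ^ (p : ℂ) = 0 := by
    obtain ⟨C, R₀, hC0, hC⟩ := exists_norm_cauchySum_le S a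
    refine integral_add_I_eq_zero (G := fun z => cauchySum S a z ^ (p : ℂ)) (C := C ^ p)
      (R₀ := R₀) hp ?_ ?_ hi
    · exact (differentiableOn_cauchySum S a).cpow (differentiableOn_const _)
        fun z hz => Or.inl (hpos z hz)
    · intro z _ hz
      rw [Complex.norm_cpow_real, Real.rpow_neg (norm_nonneg _), ← Real.inv_rpow (norm_nonneg _),
        ← Real.mul_rpow hC0 (by positivity)]
      exact Real.rpow_le_rpow (norm_nonneg _) (hC z hz) hp0.le
  have hii : Integrable fun t : ℝ => (cauchySum S a (t + Complex.I) ^ (p : ℂ)).re := hi.re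
  have hzre : ∫ t : ℝ, (cauchySum S a (t + Complex.I) ^ (p : ℂ)).re = 0 := by
    have := integral_re hi
    simp only [RCLike.re_eq_complex_re] at this
    rw [this, hzero]; rfl
  calc ∫ t : ℝ, ‖cauchySum S a (t + Complex.I)‖ ^ p
      ≤ ∫ t : ℝ, (A * (cauchySum S a (t + Complex.I)).re ^ p
          - B * (cauchySum S a (t + Complex.I) ^ (p : ℂ)).re) :=
        integral_mono hn ((hr.const_mul A).sub (hii.const_mul B)) fun t => hAB _ (hposI t)
    _ = _ := by
        rw [integral_sub (hr.const_mul A) (hii.const_mul B), integral_const_mul,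
          integral_const_mul, hzre]
        ring

/-- Convolution with the conjugate Cauchy kernel is bounded from `ℓ^p(ℤ)` to `L^p(ℝ)`. -/
def ConjCauchyBound (p : ℝ) : Prop :=
  ∃ C : ℝ≥0∞, C ≠ ∞ ∧ ∀ (S : Finset ℤ) (a : ℤ → ℂ),
    ∫⁻ t : ℝ, ‖∑ k ∈ S, a k * (conjCauchyKer (t - k) : ℂ)‖ₑ ^ p ≤ C * ∑ k ∈ S, ‖a k‖ₑ ^ p

lemma exists_lintegral_conjCauchyKer_nonneg_le {p : ℝ} (hp : 1 < p) (hp2 : p ≤ 2) :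
    ∃ C : ℝ≥0∞, C ≠ ∞ ∧ ∀ (S : Finset ℤ) (a : ℤ → ℝ), (∀ k, 0 ≤ a k) →
      ∫⁻ t : ℝ, ‖∑ k ∈ S, a k * conjCauchyKer (t - k)‖ₑ ^ p ≤ C * ∑ k ∈ S, ‖a k‖ₑ ^ p := by
  have hp0 : 0 < p := by linarith
  obtain ⟨A, B, hA, hB, hAB⟩ := exists_norm_rpow_le_re hp hp2
  obtain ⟨D, hD, hDb⟩ := exists_lintegral_sum_cauchyKer_rpow_le hp.le
  refine ⟨ENNReal.ofReal A * D, ENNReal.mul_ne_top (by simp) hD, fun S a ha => ?_⟩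
  by_cases hS : ∃ k ∈ S, 0 < a k
  swap
  -- Without a positive coefficient the real part is not positive, so this trivial case is treated
  -- apart.
  · have h0 : ∀ k ∈ S, a k = 0 := fun k hk => by
      by_contra h
      exact hS ⟨k, hk, lt_of_le_of_ne (ha k) (Ne.symm h)⟩
    have : ∀ t : ℝ, ∑ k ∈ S, a k * conjCauchyKer (t - k) = 0 := fun t =>
      Finset.sum_eq_zero fun k hk => by rw [h0 k hk, zero_mul]
    simp [this, hp0]
  have hposI : ∀ t : ℝ, 0 < (cauchySum S a (t + Complex.I)).re := fun t =>
    cauchySum_re_pos ha hS (by simp)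
  have hn := integrable_norm_cauchySum_rpow S a hp
  have hr : Integrable fun t : ℝ => (cauchySum S a (t + Complex.I)).re ^ p :=
    integrable_cauchySum_re_rpow hp ha hS
  have him : ∀ t : ℝ, (cauchySum S a (t + Complex.I)).im
      = ∑ k ∈ S, a k * conjCauchyKer (t - k) := fun t => by
    rw [cauchySum_add_I]
    simp only [Complex.add_im, Complex.ofReal_im, Complex.mul_im, Complex.ofReal_re,
        Complex.I_im, Complex.I_re, mul_one, mul_zero, add_zero, zero_add]
  have hre : ∀ t : ℝ, (cauchySum S a (t + Complex.I)).re
      = ∑ k ∈ S, a k * cauchyKer (t - k) := fun t => by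
    rw [cauchySum_add_I]
    simp only [Complex.add_re, Complex.ofReal_re, Complex.mul_re, Complex.ofReal_im,
        Complex.I_im, Complex.I_re, mul_one, mul_zero, add_zero, sub_zero]
  calc ∫⁻ t : ℝ, ‖∑ k ∈ S, a k * conjCauchyKer (t - k)‖ₑ ^ p
      ≤ ∫⁻ t : ℝ, ENNReal.ofReal (‖cauchySum S a (t + Complex.I)‖ ^ p) := by
        refine lintegral_mono fun t => ?_
        rw [← him, ← ENNReal.ofReal_rpow_of_nonneg (norm_nonneg _) hp0.le,
          ← ofReal_norm]
        exact ENNReal.rpow_le_rpow (ENNReal.ofReal_le_ofReal (Complex.abs_im_le_norm _)) hp0.le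
    _ = ENNReal.ofReal (∫ t : ℝ, ‖cauchySum S a (t + Complex.I)‖ ^ p) := by
        rw [ofReal_integral_eq_lintegral_ofReal hn
          (Eventually.of_forall fun t => Real.rpow_nonneg (norm_nonneg _) _)]
    _ ≤ ENNReal.ofReal (A * ∫ t : ℝ, (cauchySum S a (t + Complex.I)).re ^ p) :=
        ENNReal.ofReal_le_ofReal (integral_norm_cauchySum_rpow_le hp hAB ha hS)
    _ ≤ ENNReal.ofReal A *
          ∫⁻ t : ℝ, ENNReal.ofReal ((cauchySum S a (t + Complex.I)).re ^ p) := by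
        rw [ENNReal.ofReal_mul hA]
        gcongr
        rw [ofReal_integral_eq_lintegral_ofReal hr
          (Eventually.of_forall fun t => Real.rpow_nonneg (hposI t).le _)]
    _ = ENNReal.ofReal A *
          ∫⁻ t : ℝ, (∑ k ∈ S, ENNReal.ofReal (cauchyKer (t - k)) * ‖a k‖ₑ) ^ p := by
        congr 1
        refine lintegral_congr fun t => ?_
        rw [← ENNReal.ofReal_rpow_of_nonneg (hposI t).le hp0.le, hre,
          ENNReal.ofReal_sum_of_nonneg fun k _ => mul_nonneg (ha k) (cauchyKer_pos _).le]
        congr 1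
        refine Finset.sum_congr rfl fun k _ => ?_
        rw [mul_comm, ENNReal.ofReal_mul (cauchyKer_pos _).le, Real.enorm_of_nonneg (ha k)]
    _ ≤ ENNReal.ofReal A * (D * ∑ k ∈ S, ‖a k‖ₑ ^ p) := by
        gcongr
        exact hDb S _
    _ = _ := by rw [mul_assoc]

/-! ### From nonnegative to complex coefficients -/

lemma enorm_add_rpow_le {E : Type*} [NormedAddCommGroup E] {p : ℝ} (hp : 1 ≤ p) (x y : E) :
    ‖x + y‖ₑ ^ p ≤ 2 ^ (p - 1) * (‖x‖ₑ ^ p + ‖y‖ₑ ^ p) :=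
  (ENNReal.rpow_le_rpow (enorm_add_le x y) (by linarith)).trans
    (ENNReal.rpow_add_le_mul_rpow_add_rpow _ _ hp)

lemma two_rpow_ne_top (r : ℝ) : (2 : ℝ≥0∞) ^ r ≠ ∞ := by
  rw [show (2 : ℝ≥0∞) = ENNReal.ofReal 2 by simp, ENNReal.ofReal_rpow_of_pos (by norm_num)]
  simp

lemma lintegral_const_mul_add {α : Type*} [MeasurableSpace α] {μ : Measure α} (c : ℝ≥0∞)
    {f g : α → ℝ≥0∞} (hf : Measurable f) (hg : Measurable g) :
    ∫⁻ t, c * (f t + g t) ∂μ = c * ((∫⁻ t, f t ∂μ) + ∫⁻ t, g t ∂μ) := by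
  have h := lintegral_const_mul (μ := μ) c (hf.add hg)
  simp only [Pi.add_apply] at h
  rw [h, lintegral_add_left hf]

lemma conjCauchyBound_of_le_two {p : ℝ} (hp : 1 < p) (hp2 : p ≤ 2) : ConjCauchyBound p := by
  obtain ⟨C, hC, hCb⟩ := exists_lintegral_conjCauchyKer_nonneg_le hp hp2
  have hmeas : ∀ (S : Finset ℤ) (a : ℤ → ℝ),
      Measurable fun t : ℝ => ‖∑ k ∈ S, a k * conjCauchyKer (t - k)‖ₑ ^ p := by
    intro S a; unfold conjCauchyKer; fun_prop
  set D : ℝ≥0∞ := 2 ^ (p - 1) with hD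
  have hDt : D ≠ ∞ := two_rpow_ne_top _
  have hreal : ∀ (S : Finset ℤ) (a : ℤ → ℝ),
      ∫⁻ t : ℝ, ‖∑ k ∈ S, a k * conjCauchyKer (t - k)‖ₑ ^ p
        ≤ D * (2 * C) * ∑ k ∈ S, ‖a k‖ₑ ^ p := by
    intro S a
    have hpos := hCb S (fun k => max (a k) 0) (fun k => le_max_right _ _)
    have hneg := hCb S (fun k => max (-a k) 0) (fun k => le_max_right _ _)
    have h1 : ∀ x : ℝ, ‖max x 0‖ₑ ≤ ‖x‖ₑ := fun x => by
      apply enorm_le_iff_norm_le.2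
      rw [Real.norm_of_nonneg (le_max_right _ _)]
      exact max_le (le_abs_self x) (abs_nonneg x)
    calc ∫⁻ t : ℝ, ‖∑ k ∈ S, a k * conjCauchyKer (t - k)‖ₑ ^ p
        ≤ ∫⁻ t : ℝ, D * (‖∑ k ∈ S, max (a k) 0 * conjCauchyKer (t - k)‖ₑ ^ p
            + ‖∑ k ∈ S, max (-a k) 0 * conjCauchyKer (t - k)‖ₑ ^ p) := by
          refine lintegral_mono fun t => ?_
          rw [← enorm_neg (∑ k ∈ S, max (-a k) 0 * conjCauchyKer (t - k))]
          refine le_trans (le_of_eq ?_) (enorm_add_rpow_le hp.le _ _)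
          rw [← Finset.sum_neg_distrib, ← Finset.sum_add_distrib]
          congr 2
          refine Finset.sum_congr rfl fun k _ => ?_
          have : a k = max (a k) 0 - max (-a k) 0 := (max_zero_sub_eq_self (a k)).symm
          calc a k * conjCauchyKer (t - k)
              = (max (a k) 0 - max (-a k) 0) * conjCauchyKer (t - k) := by rw [← this]
            _ = _ := by ring
      _ = D * ((∫⁻ t : ℝ, ‖∑ k ∈ S, max (a k) 0 * conjCauchyKer (t - k)‖ₑ ^ p)
            + ∫⁻ t : ℝ, ‖∑ k ∈ S, max (-a k) 0 * conjCauchyKer (t - k)‖ₑ ^ p) := by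
          exact lintegral_const_mul_add D (hmeas S _) (hmeas S _)
      _ ≤ D * (C * ∑ k ∈ S, ‖a k‖ₑ ^ p + C * ∑ k ∈ S, ‖a k‖ₑ ^ p) := by
          gcongr
          · refine hpos.trans ?_
            gcongr with k
            exact h1 _
          · refine hneg.trans ?_
            gcongr with k
            refine (h1 _).trans ?_
            rw [enorm_neg]
      _ = _ := by ring
  refine ⟨D * (2 * (D * (2 * C))), by finiteness, fun S a => ?_⟩
  have hre := hreal S (fun k => (a k).re)
  have him := hreal S (fun k => (a k).im)
  have hp0 : 0 ≤ p := by linarith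
  calc ∫⁻ t : ℝ, ‖∑ k ∈ S, a k * (conjCauchyKer (t - k) : ℂ)‖ₑ ^ p
      ≤ ∫⁻ t : ℝ, D * (‖∑ k ∈ S, (a k).re * conjCauchyKer (t - k)‖ₑ ^ p
            + ‖∑ k ∈ S, (a k).im * conjCauchyKer (t - k)‖ₑ ^ p) := by
        refine lintegral_mono fun t => ?_
        have e1 : ∀ x : ℝ, ‖x‖ₑ = ‖(x : ℂ)‖ₑ := fun x => by
          rw [← ofReal_norm, ← ofReal_norm, Complex.norm_real]
        have e2 : ‖∑ k ∈ S, (a k).im * conjCauchyKer (t - k)‖ₑ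
            = ‖((∑ k ∈ S, (a k).im * conjCauchyKer (t - k) : ℝ) : ℂ) * Complex.I‖ₑ := by
          rw [e1, enorm_mul]
          rw [← ofReal_norm Complex.I, Complex.norm_I, ENNReal.ofReal_one, mul_one]
        rw [e2, e1]
        refine le_trans (le_of_eq ?_) (enorm_add_rpow_le hp.le _ _)
        congr 2
        push_cast
        rw [Finset.sum_mul, ← Finset.sum_add_distrib]
        refine Finset.sum_congr rfl fun k _ => ?_
        nth_rewrite 1 [← Complex.re_add_im (a k)]
        ring
    _ = D * ((∫⁻ t : ℝ, ‖∑ k ∈ S, (a k).re * conjCauchyKer (t - k)‖ₑ ^ p)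
            + ∫⁻ t : ℝ, ‖∑ k ∈ S, (a k).im * conjCauchyKer (t - k)‖ₑ ^ p) := by
          exact lintegral_const_mul_add D (hmeas S _) (hmeas S _)
    _ ≤ D * (D * (2 * C) * ∑ k ∈ S, ‖a k‖ₑ ^ p + D * (2 * C) * ∑ k ∈ S, ‖a k‖ₑ ^ p) := by
        gcongr
        · refine hre.trans ?_
          gcongr with k
          exact enorm_le_iff_norm_le.2 (Complex.abs_re_le_norm _)
        · refine him.trans ?_
          gcongr with k
          exact enorm_le_iff_norm_le.2 (Complex.abs_im_le_norm _)
    _ = _ := by ring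

/-! ### Discretisation, duality and exponents above two -/

/-- Discrete convolution with the conjugate Cauchy kernel is bounded on `ℓ^p(ℤ)`. -/
def DiscreteConjCauchyBound (p : ℝ) : Prop :=
  ∃ C : ℝ≥0∞, C ≠ ∞ ∧ ∀ (S : Finset ℤ) (a : ℤ → ℂ),
    ∑' n : ℤ, ‖∑ k ∈ S, a k * (conjCauchyKer (n - k) : ℂ)‖ₑ ^ p ≤ C * ∑ k ∈ S, ‖a k‖ₑ ^ p

lemma enorm_sum_conjCauchyKer_floor_sub_le (S : Finset ℤ) (a : ℤ → ℂ) (t : ℝ) :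
    ‖(∑ k ∈ S, a k * (conjCauchyKer ((⌊t⌋ : ℤ) - k) : ℂ))
        - ∑ k ∈ S, a k * (conjCauchyKer (t - k) : ℂ)‖ₑ
      ≤ ∑ k ∈ S, ENNReal.ofReal (cauchyKer (t - k)) * (3 * ‖a k‖ₑ) := by
  rw [← Finset.sum_sub_distrib]
  refine (enorm_sum_le _ _).trans (Finset.sum_le_sum fun k _ => ?_)
  rw [← mul_sub, ← Complex.ofReal_sub, enorm_mul, mul_comm, ← mul_assoc]
  gcongr
  rw [← ofReal_norm, Complex.norm_real, mul_comm, show (3 : ℝ≥0∞) = ENNReal.ofReal 3 by simp,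
    ← ENNReal.ofReal_mul (by norm_num)]
  apply ENNReal.ofReal_le_ofReal
  apply abs_conjCauchyKer_sub_le
  rw [abs_sub_comm]
  convert abs_sub_floor_le_one t using 2
  ring

lemma exists_lintegral_conjCauchyKer_floor_sub_le {p : ℝ} (hp : 1 ≤ p) :
    ∃ C : ℝ≥0∞, C ≠ ∞ ∧ ∀ (S : Finset ℤ) (a : ℤ → ℂ),
      ∫⁻ t : ℝ, ‖(∑ k ∈ S, a k * (conjCauchyKer ((⌊t⌋ : ℤ) - k) : ℂ))
          - ∑ k ∈ S, a k * (conjCauchyKer (t - k) : ℂ)‖ₑ ^ p ≤ C * ∑ k ∈ S, ‖a k‖ₑ ^ p := by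
  obtain ⟨C, hC, hCb⟩ := exists_lintegral_sum_cauchyKer_rpow_le hp
  have hp0 : 0 ≤ p := by linarith
  refine ⟨C * 3 ^ p, ENNReal.mul_ne_top hC (ENNReal.rpow_ne_top_of_nonneg hp0 (by simp)),
    fun S a => ?_⟩
  refine (lintegral_mono fun t => ENNReal.rpow_le_rpow
    (enorm_sum_conjCauchyKer_floor_sub_le S a t) hp0).trans ((hCb S _).trans (le_of_eq ?_))
  simp_rw [ENNReal.mul_rpow_of_nonneg _ _ hp0, ← Finset.mul_sum]
  rw [mul_assoc]

lemma measurable_enorm_sum_conjCauchyKer (S : Finset ℤ) (a : ℤ → ℂ) (p : ℝ) :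
    Measurable fun t : ℝ => ‖∑ k ∈ S, a k * (conjCauchyKer (t - k) : ℂ)‖ₑ ^ p := by
  unfold conjCauchyKer; fun_prop

lemma measurable_enorm_sum_conjCauchyKer_floor_sub (S : Finset ℤ) (a : ℤ → ℂ) (p : ℝ) :
    Measurable fun t : ℝ => ‖(∑ k ∈ S, a k * (conjCauchyKer ((⌊t⌋ : ℤ) - k) : ℂ))
          - ∑ k ∈ S, a k * (conjCauchyKer (t - k) : ℂ)‖ₑ ^ p := by
  unfold conjCauchyKer; fun_prop

/-- The discrete sum is the integral of a step function, which differs from the continuous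
convolution by a Cauchy-kernel term. -/
lemma ConjCauchyBound.discrete {p : ℝ} (hp : 1 ≤ p) (h : ConjCauchyBound p) :
    DiscreteConjCauchyBound p := by
  obtain ⟨C, hC, hCb⟩ := h
  obtain ⟨D, hD, hDb⟩ := exists_lintegral_conjCauchyKer_floor_sub_le hp
  have h2 := two_rpow_ne_top (p - 1)
  refine ⟨2 ^ (p - 1) * (D + C), by finiteness, fun S a => ?_⟩
  rw [← lintegral_floor fun n => ‖∑ k ∈ S, a k * (conjCauchyKer (n - k) : ℂ)‖ₑ ^ p]
  refine (lintegral_mono fun t => ?_).trans ((lintegral_const_mul_add (2 ^ (p - 1))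
    (measurable_enorm_sum_conjCauchyKer_floor_sub S a p)
    (measurable_enorm_sum_conjCauchyKer S a p)).le.trans ?_)
  · refine le_trans (le_of_eq ?_) (enorm_add_rpow_le hp _ _)
    rw [sub_add_cancel]
  · rw [mul_assoc, add_mul]
    gcongr
    · exact hDb S a
    · exact hCb S a

lemma DiscreteConjCauchyBound.continuous {p : ℝ} (hp : 1 ≤ p) (h : DiscreteConjCauchyBound p) :
    ConjCauchyBound p := by
  obtain ⟨C, hC, hCb⟩ := h
  obtain ⟨D, hD, hDb⟩ := exists_lintegral_conjCauchyKer_floor_sub_le hp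
  have h2 := two_rpow_ne_top (p - 1)
  refine ⟨2 ^ (p - 1) * (D + C), by finiteness, fun S a => ?_⟩
  refine (lintegral_mono fun t => ?_).trans ((lintegral_const_mul_add (2 ^ (p - 1))
    (measurable_enorm_sum_conjCauchyKer_floor_sub S a p)
    (g := fun t : ℝ => ‖∑ k ∈ S, a k * (conjCauchyKer ((⌊t⌋ : ℤ) - k) : ℂ)‖ₑ ^ p)
    (by unfold conjCauchyKer; fun_prop)).le.trans ?_)
  · rw [← enorm_neg ((∑ k ∈ S, a k * (conjCauchyKer ((⌊t⌋ : ℤ) - k) : ℂ))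
          - ∑ k ∈ S, a k * (conjCauchyKer (t - k) : ℂ))]
    refine le_trans (le_of_eq ?_) (enorm_add_rpow_le hp _ _)
    rw [neg_sub, sub_add_cancel]
  · rw [mul_assoc, add_mul]
    gcongr
    · exact hDb S a
    · rw [lintegral_floor fun n => ‖∑ k ∈ S, a k * (conjCauchyKer (n - k) : ℂ)‖ₑ ^ p]
      exact hCb S a

lemma conjCauchyKer_neg (t : ℝ) : conjCauchyKer (-t) = -conjCauchyKer t := by
  unfold conjCauchyKer; ring

/-- The kernel is antisymmetric, so boundedness passes to the conjugate exponent. -/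
lemma DiscreteConjCauchyBound.dual {p q : ℝ} (hp : 2 ≤ p) (hpq : p.HolderConjugate q)
    (h : DiscreteConjCauchyBound q) : DiscreteConjCauchyBound p := by
  obtain ⟨C, hC, hCb⟩ := h
  have hp0 : 0 < p := by linarith
  have hq0 : 0 < q := hpq.symm.pos
  refine ⟨(C ^ (1 / q)) ^ p, ENNReal.rpow_ne_top_of_nonneg hp0.le
    (ENNReal.rpow_ne_top_of_nonneg (by positivity) hC), fun S a => ?_⟩
  rw [ENNReal.tsum_eq_iSup_sum]
  -- Restricting to a finite `N` makes `Y` below finite, so that `Y ^ (1 / q)` can be cancelled.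
  refine iSup_le fun N => ?_
  set y : ℤ → ℂ := fun n => ∑ k ∈ S, a k * (conjCauchyKer (n - k) : ℂ) with hy
  -- The extremal test sequence in Hölder's inequality: `y b = |y| ^ p` and `|b| ^ q = |y| ^ p`.
  set b : ℤ → ℂ := fun n => (starRingEnd ℂ) (y n) * ((‖y n‖ ^ (p - 2) : ℝ) : ℂ) with hb
  have hyb : ∀ n, y n * b n = ((‖y n‖ ^ p : ℝ) : ℂ) := fun n => by
    rw [hb]
    simp only
    rw [← mul_assoc, Complex.mul_conj, ← Complex.ofReal_mul, Complex.normSq_eq_norm_sq,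
      ← Real.rpow_natCast, ← Real.rpow_add_of_nonneg (norm_nonneg _) (by simp) (by linarith)]
    congr 2
    push_cast; ring
  have hbn : ∀ n, ‖b n‖ₑ ^ q = ‖y n‖ₑ ^ p := fun n => by
    have h1 : ‖b n‖ = ‖y n‖ ^ (p - 1) := by
      rw [hb]
      simp only
      rw [norm_mul, RCLike.norm_conj, Complex.norm_real,
        Real.norm_of_nonneg (Real.rpow_nonneg (norm_nonneg _) _)]
      nth_rewrite 1 [← Real.rpow_one ‖y n‖]
      rw [← Real.rpow_add_of_nonneg (norm_nonneg _) (by simp) (by linarith)]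
      congr 1; ring
    rw [← ofReal_norm, h1, ← ENNReal.ofReal_rpow_of_nonneg (norm_nonneg _) (by linarith),
      ofReal_norm, ← ENNReal.rpow_mul, hpq.sub_one_mul_conj]
  set Y : ℝ≥0∞ := ∑ n ∈ N, ‖y n‖ₑ ^ p with hY
  have hYtop : Y ≠ ∞ := by
    rw [hY]
    exact ENNReal.sum_ne_top.2 fun n _ => ENNReal.rpow_ne_top_of_nonneg hp0.le enorm_ne_top
  have hYle : Y ≤ (∑ k ∈ S, ‖a k‖ₑ ^ p) ^ (1 / p) * (C ^ (1 / q) * Y ^ (1 / q)) := by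
    have e1 : Y = ‖∑ n ∈ N, y n * b n‖ₑ := by
      simp_rw [hyb]
      rw [← Complex.ofReal_sum, ← ofReal_norm, Complex.norm_real, Real.norm_of_nonneg
        (Finset.sum_nonneg fun n _ => Real.rpow_nonneg (norm_nonneg _) _),
        ENNReal.ofReal_sum_of_nonneg fun n _ => Real.rpow_nonneg (norm_nonneg _) _, hY]
      refine Finset.sum_congr rfl fun n _ => ?_
      rw [← ENNReal.ofReal_rpow_of_nonneg (norm_nonneg _) hp0.le, ofReal_norm]
    -- The operator is moved onto `b`; antisymmetry of the kernel makes its transpose its negative.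
    have e2 : ∑ n ∈ N, y n * b n
        = ∑ k ∈ S, a k * -(∑ n ∈ N, b n * (conjCauchyKer (k - n) : ℂ)) := by
      simp_rw [hy, Finset.sum_mul]
      rw [Finset.sum_comm]
      refine Finset.sum_congr rfl fun k _ => ?_
      rw [← Finset.sum_neg_distrib, Finset.mul_sum]
      refine Finset.sum_congr rfl fun n _ => ?_
      rw [← neg_sub (n : ℝ) k, conjCauchyKer_neg]
      push_cast; ring
    calc Y ≤ ∑ k ∈ S, ‖a k‖ₑ * ‖∑ n ∈ N, b n * (conjCauchyKer (k - n) : ℂ)‖ₑ := by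
          rw [e1, e2]
          refine (enorm_sum_le _ _).trans (le_of_eq ?_)
          refine Finset.sum_congr rfl fun k _ => ?_
          rw [enorm_mul, enorm_neg]
      _ ≤ (∑ k ∈ S, ‖a k‖ₑ ^ p) ^ (1 / p) *
            (∑ k ∈ S, ‖∑ n ∈ N, b n * (conjCauchyKer (k - n) : ℂ)‖ₑ ^ q) ^ (1 / q) :=
          ENNReal.inner_le_Lp_mul_Lq _ _ _ hpq
      _ ≤ (∑ k ∈ S, ‖a k‖ₑ ^ p) ^ (1 / p) * (C * Y) ^ (1 / q) := by
          gcongr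
          refine (ENNReal.sum_le_tsum S).trans ((hCb N b).trans (le_of_eq ?_))
          simp_rw [hbn, hY]
      _ = _ := by rw [ENNReal.mul_rpow_of_nonneg _ _ (by positivity)]
  rcases eq_or_ne Y 0 with hY0 | hY0
  · rw [hY0]; exact zero_le
  have hYq0 : Y ^ (1 / q) ≠ 0 := by
    rw [ne_eq, ENNReal.rpow_eq_zero_iff]; push Not
    exact ⟨fun h => absurd h hY0, fun h => absurd h hYtop⟩
  have hYq : Y ^ (1 / q) ≠ ∞ := ENNReal.rpow_ne_top_of_nonneg (by positivity) hYtop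
  have hsplit : Y = Y ^ (1 / p) * Y ^ (1 / q) := by
    rw [← ENNReal.rpow_add _ _ hY0 hYtop, one_div, one_div, hpq.inv_add_inv_eq_one,
      ENNReal.rpow_one]
  have h3 : Y ^ (1 / p) ≤ (∑ k ∈ S, ‖a k‖ₑ ^ p) ^ (1 / p) * C ^ (1 / q) := by
    rw [← ENNReal.mul_le_mul_iff_left hYq0 hYq, ← hsplit, mul_assoc]
    exact hYle
  calc Y = (Y ^ (1 / p)) ^ p := by
        rw [← ENNReal.rpow_mul, one_div, inv_mul_cancel₀ hp0.ne', ENNReal.rpow_one]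
    _ ≤ ((∑ k ∈ S, ‖a k‖ₑ ^ p) ^ (1 / p) * C ^ (1 / q)) ^ p := by gcongr
    _ = _ := by
        rw [ENNReal.mul_rpow_of_nonneg _ _ hp0.le, ← ENNReal.rpow_mul, one_div,
          inv_mul_cancel₀ hp0.ne', ENNReal.rpow_one, mul_comm]

lemma conjCauchyBound {p : ℝ} (hp : 1 < p) : ConjCauchyBound p := by
  rcases le_total p 2 with h | h
  · exact conjCauchyBound_of_le_two hp h
  · have hpq := Real.HolderConjugate.conjExponent hp
    refine DiscreteConjCauchyBound.continuous hp.le (DiscreteConjCauchyBound.dual h hpq ?_)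
    refine (conjCauchyBound_of_le_two hpq.symm.lt ?_).discrete hpq.symm.lt.le
    rw [Real.conjExponent, div_le_iff₀ (by linarith)]
    linarith

/-! ### The Plancherel-Pólya inequality for finite sampling series -/

/-- The singularity is removable: `csinc z` is the difference quotient of `sin` at `0`, evaluated at
`π z`. -/
lemma differentiable_csinc : Differentiable ℂ csinc := by
  have h : csinc = fun z : ℂ => dslope Complex.sin 0 (Real.pi * z) := by
    funext z
    unfold csinc
    split_ifs with hz
    · simp [hz]
    · have h0 : (Real.pi : ℂ) * z ≠ 0 := mul_ne_zero (by exact_mod_cast Real.pi_ne_zero) hz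
      rw [dslope_of_ne _ h0, slope_def_field]
      simp
  have h2 : Differentiable ℂ (dslope Complex.sin 0) := by
    rw [← differentiableOn_univ, Complex.differentiableOn_dslope (by simp)]
    exact Complex.differentiable_sin.differentiableOn
  rw [h]
  exact h2.comp (by fun_prop)

lemma norm_cos_le (z : ℂ) : ‖Complex.cos z‖ ≤ Real.exp |z.im| := by
  unfold Complex.cos
  have h1 : ‖Complex.exp (z * Complex.I)‖ ≤ Real.exp |z.im| := by
    rw [Complex.norm_exp]
    simpa using Real.exp_le_exp.2 (neg_le_abs z.im)
  have h2 : ‖Complex.exp (-z * Complex.I)‖ ≤ Real.exp |z.im| := by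
    rw [Complex.norm_exp]
    simpa using Real.exp_le_exp.2 (le_abs_self z.im)
  rw [norm_div]
  have := norm_add_le (Complex.exp (z * Complex.I)) (Complex.exp (-z * Complex.I))
  simp only [Complex.norm_ofNat]
  linarith

lemma norm_sin_le (z : ℂ) : ‖Complex.sin z‖ ≤ Real.exp |z.im| := by
  have := norm_cos_le (z - Real.pi / 2)
  rw [Complex.cos_sub_pi_div_two] at this
  convert this using 3
  have : ((Real.pi : ℂ) / 2).im = 0 := by
    rw [show (Real.pi : ℂ) / 2 = ((Real.pi / 2 : ℝ) : ℂ) by push_cast; ring, Complex.ofReal_im]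
  simp [this]

/-- Mean value inequality on the convex strip `|Im w| ≤ |Im z|`, where the derivative `cos` is at
most `exp |Im z|`. -/
lemma norm_sin_le_norm_mul (z : ℂ) : ‖Complex.sin z‖ ≤ Real.exp |z.im| * ‖z‖ := by
  have hconv : Convex ℝ {w : ℂ | |w.im| ≤ |z.im|} := by
    have : {w : ℂ | |w.im| ≤ |z.im|} = Complex.imLm ⁻¹' Set.Icc (-|z.im|) |z.im| := by
      ext w; simp [abs_le]
    rw [this]
    exact (convex_Icc _ _).linear_preimage _
  have := hconv.norm_image_sub_le_of_norm_deriv_le (f := Complex.sin) (C := Real.exp |z.im|)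
    (x := 0) (y := z) (fun w _ => Complex.differentiable_sin w) (fun w hw => by
      rw [Complex.deriv_sin]
      exact (norm_cos_le w).trans (Real.exp_le_exp.2 hw)) (by simp) (by simp)
  simpa using this

lemma norm_csinc_le (z : ℂ) : ‖csinc z‖ ≤ Real.exp (Real.pi * |z.im|) := by
  unfold csinc
  split_ifs with hz
  · rw [norm_one]; exact Real.one_le_exp (by positivity)
  · have h0 : (Real.pi : ℂ) * z ≠ 0 := mul_ne_zero (by exact_mod_cast Real.pi_ne_zero) hz
    rw [norm_div, div_le_iff₀ (norm_pos_iff.2 h0)]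
    refine (norm_sin_le_norm_mul _).trans (le_of_eq ?_)
    rw [Complex.im_ofReal_mul, abs_mul, abs_of_pos Real.pi_pos]

lemma norm_mul_norm_csinc_le (z : ℂ) : ‖z‖ * ‖csinc z‖ ≤ Real.exp (Real.pi * |z.im|) := by
  unfold csinc
  split_ifs with hz
  · rw [hz, norm_zero, zero_mul]; positivity
  · have hz' : ‖z‖ ≠ 0 := norm_ne_zero_iff.2 hz
    have h1 := norm_sin_le (Real.pi * z)
    rw [Complex.im_ofReal_mul, abs_mul, abs_of_pos Real.pi_pos] at h1
    rw [norm_div, norm_mul, Complex.norm_real, Real.norm_of_nonneg Real.pi_pos.le]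
    calc ‖z‖ * (‖Complex.sin (Real.pi * z)‖ / (Real.pi * ‖z‖))
        = ‖Complex.sin (Real.pi * z)‖ / Real.pi := by field_simp
      _ ≤ ‖Complex.sin (Real.pi * z)‖ / 1 := by
          gcongr
          linarith [Real.pi_gt_three]
      _ ≤ _ := by rw [div_one]; exact h1

/-- Combines boundedness near `0` with decay like `1 / |Re z|`. The square root of the Cauchy kernel
has summable `q`-th powers over integer shifts for every `q > 1`. -/
lemma norm_csinc_le_cauchyKer (z : ℂ) :
    ‖csinc z‖ ≤ 2 * Real.exp (Real.pi * |z.im|) * cauchyKer z.re ^ (1 / 2 : ℝ) := by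
  have h1 := norm_csinc_le z
  have h2 := norm_mul_norm_csinc_le z
  set E := Real.exp (Real.pi * |z.im|)
  have hE : 0 < E := Real.exp_pos _
  have h3 : |z.re| * ‖csinc z‖ ≤ E :=
    (mul_le_mul_of_nonneg_right (Complex.abs_re_le_norm z) (norm_nonneg _)).trans h2
  have h4 : (1 + z.re ^ 2) * ‖csinc z‖ ^ 2 ≤ 2 * E ^ 2 := by
    have a1 : ‖csinc z‖ ^ 2 ≤ E ^ 2 := by gcongr
    have a2 : (|z.re| * ‖csinc z‖) ^ 2 ≤ E ^ 2 := by gcongr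
    rw [mul_pow, sq_abs] at a2
    linarith
  rw [← Real.sqrt_eq_rpow]
  apply le_of_sq_le_sq _ (by positivity)
  rw [mul_pow, mul_pow, Real.sq_sqrt (cauchyKer_pos _).le]
  unfold cauchyKer
  rw [← div_eq_mul_inv, le_div_iff₀ (by positivity)]
  nlinarith [sq_nonneg E]

/-- For `t ≠ 0` this is `1 / t = t / (1 + t²) + 1 / (t (1 + t²))` multiplied by `sin (π t) / π`. -/
lemma csinc_ofReal_eq (t : ℝ) :
    csinc t = Complex.sin (Real.pi * t) / Real.pi * (conjCauchyKer t : ℂ)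
      + csinc t * (cauchyKer t : ℂ) := by
  unfold csinc conjCauchyKer cauchyKer
  have h1 : (1 + (t : ℂ) ^ 2) ≠ 0 := by
    have : (1 + t ^ 2 : ℝ) ≠ 0 := by positivity
    exact_mod_cast this
  have hpi : (Real.pi : ℂ) ≠ 0 := by exact_mod_cast Real.pi_ne_zero
  split_ifs with hz
  · simp only [Complex.ofReal_eq_zero] at hz
    subst hz; simp
  · push_cast
    field_simp
    ring

lemma csinc_sub_intCast_eq (t : ℝ) (k : ℤ) :
    csinc (t - k) = Complex.sin (Real.pi * t) / Real.pi * ((-1) ^ k * (conjCauchyKer (t - k) : ℂ))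
      + csinc (t - k) * (cauchyKer (t - k) : ℂ) := by
  have h := csinc_ofReal_eq (t - k)
  push_cast at h
  have hs : Complex.sin (Real.pi * ((t : ℂ) - k)) = (-1) ^ k * Complex.sin (Real.pi * t) := by
    rw [mul_sub, mul_comm (Real.pi : ℂ) (k : ℂ)]
    rw [Complex.sin_antiperiodic.sub_int_mul_eq, Int.cast_negOnePow]
  rw [hs] at h
  linear_combination h

/-- The Plancherel-Pólya inequality for finite sampling series. -/
lemma exists_lintegral_sum_csinc_le {p : ℝ} (hp : 1 < p) :
    ∃ C : ℝ≥0∞, C ≠ ∞ ∧ ∀ (S : Finset ℤ) (x : ℤ → ℂ),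
      ∫⁻ t : ℝ, ‖∑ k ∈ S, x k * csinc (t - k)‖ₑ ^ p ≤ C * ∑ k ∈ S, ‖x k‖ₑ ^ p := by
  obtain ⟨C, hC, hCb⟩ := conjCauchyBound hp
  obtain ⟨D, hD, hDb⟩ := exists_lintegral_sum_cauchyKer_rpow_le hp.le
  have hp0 : 0 < p := by linarith
  have h2 := two_rpow_ne_top (p - 1)
  refine ⟨2 ^ (p - 1) * (C + D), by finiteness, fun S x => ?_⟩
  refine (lintegral_mono fun t => ?_).trans ((lintegral_const_mul_add (2 ^ (p - 1))
    (measurable_enorm_sum_conjCauchyKer S (fun k => x k * (-1) ^ k) p)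
    (g := fun t : ℝ => (∑ k ∈ S, ENNReal.ofReal (cauchyKer (t - k)) * ‖x k‖ₑ) ^ p)
    (by unfold cauchyKer; fun_prop)).le.trans ?_)
  -- The sine factor does not depend on `k` and has modulus at most 1; the signs are absorbed into
  -- the coefficients.
  · have e : ∑ k ∈ S, x k * csinc (t - k)
        = Complex.sin (Real.pi * t) / Real.pi *
            ∑ k ∈ S, x k * (-1) ^ k * (conjCauchyKer (t - k) : ℂ)
          + ∑ k ∈ S, (cauchyKer (t - k) : ℂ) * x k * csinc (t - k) := by
      rw [Finset.mul_sum, ← Finset.sum_add_distrib]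
      refine Finset.sum_congr rfl fun k _ => ?_
      nth_rewrite 1 [csinc_sub_intCast_eq]
      ring
    rw [e]
    refine (enorm_add_rpow_le hp.le _ _).trans ?_
    gcongr 2 ^ (p - 1) * (?_ ^ p + ?_ ^ p)
    · rw [enorm_mul]
      apply mul_le_of_le_one_left'
      rw [← ofReal_norm, ENNReal.ofReal_le_one, norm_div, Complex.norm_real,
        Real.norm_of_nonneg Real.pi_pos.le, div_le_one Real.pi_pos]
      have := norm_sin_le (Real.pi * t)
      rw [← Complex.ofReal_mul, Complex.ofReal_im, abs_zero, Real.exp_zero] at this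
      rw [← Complex.ofReal_mul]
      linarith [Real.pi_gt_three]
    · refine (enorm_sum_le _ _).trans (Finset.sum_le_sum fun k _ => ?_)
      rw [enorm_mul, enorm_mul, ← ofReal_norm (cauchyKer (t - k) : ℂ), Complex.norm_real,
        Real.norm_of_nonneg (cauchyKer_pos _).le]
      apply mul_le_of_le_one_right'
      rw [← ofReal_norm, ENNReal.ofReal_le_one]
      have := norm_csinc_le (t - k)
      simpa using this
  · rw [mul_assoc, add_mul]
    gcongr
    · refine (hCb S _).trans (le_of_eq ?_)
      congr 1
      refine Finset.sum_congr rfl fun k _ => ?_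
      rw [enorm_mul]
      have : ‖((-1 : ℂ) ^ k)‖ₑ = 1 := by rw [← ofReal_norm]; simp
      rw [this, mul_one]
    · exact hDb S _

/-! ### Shannon sampling series with coefficients in `ℓ^p` -/

/-- The Shannon sampling series. -/
noncomputable def shannonSeries (x : ℤ → ℂ) (z : ℂ) : ℂ := ∑' k : ℤ, x k * csinc (z - k)

lemma ellNorm_eq {p : ℝ} (hp : 0 < p) (x : ℤ → ℂ) :
    ellNorm p x = (∑' k : ℤ, ‖x k‖ₑ ^ p) ^ (1 / p) := by
  rw [ellNorm, eLpNorm_eq_lintegral_rpow_enorm_toReal (by simpa using hp) (by simp),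
    lintegral_count, ENNReal.toReal_ofReal hp.le]

lemma bernsteinNorm_eq {p : ℝ} (hp : 0 < p) (f : ℂ → ℂ) :
    bernsteinNorm p f = (∫⁻ t : ℝ, ‖f t‖ₑ ^ p) ^ (1 / p) := by
  rw [bernsteinNorm, eLpNorm_eq_lintegral_rpow_enorm_toReal (by simpa using hp) (by simp),
    ENNReal.toReal_ofReal hp.le]

lemma mem_ellSpace_iff {p : ℝ} (hp : 0 < p) (x : ℤ → ℂ) :
    x ∈ ellSpace p ↔ ∑' k : ℤ, ‖x k‖ₑ ^ p ≠ ∞ := by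
  have h : x ∈ ellSpace p ↔ eLpNorm x (ENNReal.ofReal p) Measure.count < ∞ :=
    ⟨fun h => h.2, fun h => ⟨(measurable_of_countable x).aestronglyMeasurable, h⟩⟩
  rw [h, eLpNorm_lt_top_iff_lintegral_rpow_enorm_lt_top (by simpa using hp) (by simp),
    lintegral_count, ENNReal.toReal_ofReal hp.le, lt_top_iff_ne_top]

lemma exists_tsum_enorm_csinc_rpow_le {q : ℝ} (hq : 1 < q) :
    ∃ M : ℝ≥0∞, M ≠ ∞ ∧ ∀ z : ℂ, ∑' k : ℤ, ‖csinc (z - k)‖ₑ ^ q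
      ≤ M * ENNReal.ofReal (Real.exp (Real.pi * |z.im|)) ^ q := by
  obtain ⟨M, hM, hMb⟩ := exists_tsum_cauchyKer_rpow_le hq
  have hq0 : 0 < q := by linarith
  refine ⟨2 ^ q * M, ENNReal.mul_ne_top (two_rpow_ne_top q) hM, fun z => ?_⟩
  calc ∑' k : ℤ, ‖csinc (z - k)‖ₑ ^ q
      ≤ ∑' k : ℤ, (2 * ENNReal.ofReal (Real.exp (Real.pi * |z.im|))) ^ q
          * ENNReal.ofReal (cauchyKer (z.re - k)) ^ (q / 2) := by
        refine ENNReal.tsum_le_tsum fun k => ?_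
        have h := ENNReal.ofReal_le_ofReal (norm_csinc_le_cauchyKer (z - k))
        simp only [Complex.sub_im, Complex.intCast_im, sub_zero, Complex.sub_re,
          Complex.intCast_re] at h
        rw [ENNReal.ofReal_mul (by positivity), ENNReal.ofReal_mul (by norm_num),
          ← ENNReal.ofReal_rpow_of_nonneg (cauchyKer_pos _).le (by norm_num), ofReal_norm] at h
        refine (ENNReal.rpow_le_rpow h hq0.le).trans (le_of_eq ?_)
        rw [ENNReal.mul_rpow_of_nonneg _ _ hq0.le, ← ENNReal.rpow_mul]
        congr 2
        · simp
        · ring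
    _ ≤ (2 * ENNReal.ofReal (Real.exp (Real.pi * |z.im|))) ^ q * M := by
        rw [ENNReal.tsum_mul_left]
        gcongr
        exact hMb z.re
    _ = _ := by rw [ENNReal.mul_rpow_of_nonneg _ _ hq0.le]; ring

/-- Hölder with the conjugate exponent. Uniformity in `Re z` yields convergence on strips; the
exponential factor yields type `π`. -/
lemma exists_tsum_enorm_mul_csinc_le {p : ℝ} (hp : 1 < p) :
    ∃ M : ℝ≥0∞, M ≠ ∞ ∧ ∀ (x : ℤ → ℂ) (z : ℂ), ∑' k : ℤ, ‖x k * csinc (z - k)‖ₑ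
      ≤ M * ellNorm p x * ENNReal.ofReal (Real.exp (Real.pi * |z.im|)) := by
  have hpq := Real.HolderConjugate.conjExponent hp
  set q := p.conjExponent
  have hq0 : 0 < q := hpq.symm.pos
  have hp0 : 0 < p := hpq.pos
  obtain ⟨M, hM, hMb⟩ := exists_tsum_enorm_csinc_rpow_le hpq.symm.lt
  refine ⟨M ^ (1 / q), ENNReal.rpow_ne_top_of_nonneg (by positivity) hM, fun x z => ?_⟩
  rw [ENNReal.tsum_eq_iSup_sum]
  refine iSup_le fun S => ?_
  simp_rw [enorm_mul]
  refine (ENNReal.inner_le_Lp_mul_Lq S _ _ hpq).trans ?_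
  calc _ ≤ (∑' k : ℤ, ‖x k‖ₑ ^ p) ^ (1 / p)
        * (M * ENNReal.ofReal (Real.exp (Real.pi * |z.im|)) ^ q) ^ (1 / q) := by
        gcongr
        · exact ENNReal.sum_le_tsum S
        · exact (ENNReal.sum_le_tsum S).trans (hMb z)
    _ = _ := by
        rw [ENNReal.mul_rpow_of_nonneg _ _ (by positivity), ← ENNReal.rpow_mul,
          mul_one_div_cancel hq0.ne', ENNReal.rpow_one, ellNorm_eq hp0]
        ring

lemma ellNorm_ne_top {p : ℝ} {x : ℤ → ℂ} (hx : x ∈ ellSpace p) : ellNorm p x ≠ ∞ :=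
  hx.2.ne

lemma summable_mul_csinc {p : ℝ} (hp : 1 < p) {x : ℤ → ℂ} (hx : x ∈ ellSpace p) (z : ℂ) :
    Summable fun k : ℤ => x k * csinc (z - k) := by
  obtain ⟨M, hM, hMb⟩ := exists_tsum_enorm_mul_csinc_le hp
  refine Summable.of_norm (tsum_enorm_ne_top_iff_summable_norm.1 (ne_top_of_le_ne_top ?_ (hMb x z)))
  exact ENNReal.mul_ne_top (ENNReal.mul_ne_top hM (ellNorm_ne_top hx)) (by simp)

lemma exists_enorm_shannonSeries_le {p : ℝ} (hp : 1 < p) :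
    ∃ M : ℝ≥0∞, M ≠ ∞ ∧ ∀ (x : ℤ → ℂ) (z : ℂ), ‖shannonSeries x z‖ₑ
      ≤ M * ellNorm p x * ENNReal.ofReal (Real.exp (Real.pi * |z.im|)) := by
  obtain ⟨M, hM, hMb⟩ := exists_tsum_enorm_mul_csinc_le hp
  exact ⟨M, hM, fun x z => enorm_tsum_le_tsum_enorm.trans (hMb x z)⟩

lemma shannonSeries_indicator (S : Finset ℤ) (x : ℤ → ℂ) (z : ℂ) :
    shannonSeries ((S : Set ℤ).indicator x) z = ∑ k ∈ S, x k * csinc (z - k) := by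
  rw [shannonSeries, tsum_eq_sum (s := S)]
  · refine Finset.sum_congr rfl fun k hk => ?_
    rw [Set.indicator_of_mem (by simpa using hk)]
  · intro k hk
    rw [Set.indicator_of_notMem (by simpa using hk), zero_mul]

lemma indicator_mem_ellSpace {p : ℝ} {x : ℤ → ℂ} (hx : x ∈ ellSpace p) (s : Set ℤ) :
    s.indicator x ∈ ellSpace p :=
  MemLp.indicator (by measurability) hx

lemma shannonSeries_sub {p : ℝ} (hp : 1 < p) {x y : ℤ → ℂ} (hx : x ∈ ellSpace p)
    (hy : y ∈ ellSpace p) (z : ℂ) :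
    shannonSeries (x - y) z = shannonSeries x z - shannonSeries y z := by
  unfold shannonSeries
  rw [← (summable_mul_csinc hp hx z).tsum_sub (summable_mul_csinc hp hy z)]
  exact tsum_congr fun k => by rw [Pi.sub_apply, sub_mul]

lemma tendsto_ellNorm_indicator_compl {p : ℝ} (hp : 0 < p) {x : ℤ → ℂ} (hx : x ∈ ellSpace p) :
    Tendsto (fun S : Finset ℤ => ellNorm p ((S : Set ℤ)ᶜ.indicator x)) atTop (𝓝 0) := by
  have h := ENNReal.tendsto_tsum_compl_atTop_zero ((mem_ellSpace_iff hp x).1 hx)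
  have h2 := h.ennrpow_const (1 / p)
  rw [ENNReal.zero_rpow_of_pos (by positivity)] at h2
  refine h2.congr fun S => ?_
  rw [ellNorm_eq hp]
  congr 1
  rw [show (∑' b : {k // k ∉ S}, ‖x b‖ₑ ^ p) = ∑' k, ((S : Set ℤ)ᶜ).indicator
    (fun k => ‖x k‖ₑ ^ p) k from tsum_subtype ((S : Set ℤ)ᶜ) fun k => ‖x k‖ₑ ^ p]
  refine tsum_congr fun k => ?_
  by_cases hk : k ∈ (S : Set ℤ)ᶜ
  · simp [Set.indicator_of_mem hk]
  · simp [Set.indicator_of_notMem hk, hp]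

/-- The sampling series converges uniformly on horizontal strips. -/
lemma eventually_norm_shannonSeries_sub_lt {p : ℝ} (hp : 1 < p) {x : ℤ → ℂ}
    (hx : x ∈ ellSpace p) (h : ℝ) {ε : ℝ} (hε : 0 < ε) :
    ∀ᶠ S : Finset ℤ in atTop, ∀ z : ℂ, |z.im| ≤ h →
      ‖shannonSeries x z - ∑ k ∈ S, x k * csinc (z - k)‖ < ε := by
  obtain ⟨M, hM, hMb⟩ := exists_enorm_shannonSeries_le hp
  have hp0 : 0 < p := by linarith
  have hlim := ENNReal.Tendsto.mul_const (b := ENNReal.ofReal (Real.exp (Real.pi * h)))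
    (ENNReal.Tendsto.const_mul (tendsto_ellNorm_indicator_compl hp0 hx) (Or.inr hM))
    (Or.inr (by simp))
  rw [mul_zero, zero_mul] at hlim
  filter_upwards [hlim.eventually_lt_const (ENNReal.ofReal_pos.2 hε)] with S hS z hz
  have e : shannonSeries x z - ∑ k ∈ S, x k * csinc (z - k)
      = shannonSeries ((S : Set ℤ)ᶜ.indicator x) z := by
    rw [← shannonSeries_indicator, ← shannonSeries_sub hp hx (indicator_mem_ellSpace hx _),
      ← Set.indicator_compl]
  rw [e, ← ENNReal.ofReal_lt_ofReal_iff hε, ofReal_norm]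
  refine lt_of_le_of_lt (hMb _ z) (lt_of_le_of_lt ?_ hS)
  gcongr

lemma differentiable_sum_csinc (S : Finset ℤ) (x : ℤ → ℂ) :
    Differentiable ℂ fun z => ∑ k ∈ S, x k * csinc (z - k) := by
  have h : ∀ k : ℤ, Differentiable ℂ fun z : ℂ => csinc (z - k) := fun k =>
    differentiable_csinc.comp (by fun_prop)
  fun_prop

lemma differentiable_shannonSeries {p : ℝ} (hp : 1 < p) {x : ℤ → ℂ} (hx : x ∈ ellSpace p) :
    Differentiable ℂ (shannonSeries x) := by
  have h : TendstoLocallyUniformlyOn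
      (fun (S : Finset ℤ) (z : ℂ) => ∑ k ∈ S, x k * csinc (z - k)) (shannonSeries x) atTop
      Set.univ := by
    rw [tendstoLocallyUniformlyOn_univ, Metric.tendstoLocallyUniformly_iff]
    intro ε hε z
    refine ⟨{w | |w.im| < |z.im| + 1}, ?_, ?_⟩
    · exact (isOpen_lt (by fun_prop) (by fun_prop)).mem_nhds (by simp)
    · filter_upwards [eventually_norm_shannonSeries_sub_lt hp hx (|z.im| + 1) hε] with S hS w hw
      rw [dist_eq_norm]
      exact hS w (le_of_lt hw)
  rw [← differentiableOn_univ]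
  exact h.differentiableOn (Eventually.of_forall fun S =>
    (differentiable_sum_csinc S x).differentiableOn) isOpen_univ

lemma tendsto_csinc_sub_cocompact (k : ℤ) :
    Tendsto (fun t : ℝ => csinc (t - k)) (cocompact ℝ) (𝓝 0) := by
  have h1 : Tendsto (fun t : ℝ => ‖t - k‖⁻¹) (cocompact ℝ) (𝓝 0) := by
    refine tendsto_inv_atTop_zero.comp (tendsto_norm_cocompact_atTop.comp ?_)
    exact (Homeomorph.subRight (k : ℝ)).isClosedEmbedding.tendsto_cocompact
  refine squeeze_zero_norm' ?_ h1
  have h2 : ∀ᶠ t : ℝ in cocompact ℝ, t ∈ ({(k : ℝ)} : Set ℝ)ᶜ :=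
    isCompact_singleton.compl_mem_cocompact
  filter_upwards [h2] with t ht
  have h3 := norm_mul_norm_csinc_le (t - k)
  have h4 : ‖(t : ℂ) - k‖ = ‖t - k‖ := by
    rw [← Complex.norm_real]; push_cast; rfl
  have h5 : 0 < ‖t - k‖ := norm_pos_iff.2 (sub_ne_zero.2 (by simpa using ht))
  rw [h4] at h3
  rw [← one_div, le_div_iff₀ h5, mul_comm]
  simpa using h3

lemma tendsto_shannonSeries_cocompact {p : ℝ} (hp : 1 < p) {x : ℤ → ℂ} (hx : x ∈ ellSpace p) :
    Tendsto (fun t : ℝ => shannonSeries x t) (cocompact ℝ) (𝓝 0) := by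
  rw [Metric.tendsto_nhds]
  intro ε hε
  obtain ⟨S, hS⟩ := (eventually_norm_shannonSeries_sub_lt hp hx 0 (half_pos hε)).exists
  have h : Tendsto (fun t : ℝ => ∑ k ∈ S, x k * csinc (t - k)) (cocompact ℝ) (𝓝 0) := by
    have := tendsto_finsetSum S fun k _ => (tendsto_csinc_sub_cocompact k).const_mul (x k)
    simpa using this
  filter_upwards [Metric.tendsto_nhds.1 h _ (half_pos hε)] with t ht
  rw [dist_zero_right] at ht ⊢
  have h1 := hS t (by simp)
  calc ‖shannonSeries x t‖
      = ‖(shannonSeries x t - ∑ k ∈ S, x k * csinc (t - k)) + ∑ k ∈ S, x k * csinc (t - k)‖ := by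
        rw [sub_add_cancel]
    _ ≤ _ := norm_add_le _ _
    _ < ε := by linarith

/-- The Plancherel-Pólya inequality for sampling series. -/
lemma exists_lintegral_shannonSeries_le {p : ℝ} (hp : 1 < p) :
    ∃ C : ℝ≥0∞, C ≠ ∞ ∧ ∀ x ∈ ellSpace p,
      ∫⁻ t : ℝ, ‖shannonSeries x t‖ₑ ^ p ≤ C * ∑' k : ℤ, ‖x k‖ₑ ^ p := by
  obtain ⟨C, hC, hCb⟩ := exists_lintegral_sum_csinc_le hp
  refine ⟨C, hC, fun x hx => ?_⟩
  have hlim : ∀ t : ℝ, Tendsto (fun S : Finset ℤ => ‖∑ k ∈ S, x k * csinc (t - k)‖ₑ ^ p) atTop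
      (𝓝 (‖shannonSeries x t‖ₑ ^ p)) := fun t =>
    (((summable_mul_csinc hp hx t).hasSum).enorm).ennrpow_const p
  calc ∫⁻ t : ℝ, ‖shannonSeries x t‖ₑ ^ p
      -- Fatou's lemma along the finite partial sums.
      = ∫⁻ t : ℝ, liminf (fun S : Finset ℤ => ‖∑ k ∈ S, x k * csinc (t - k)‖ₑ ^ p) atTop :=
        lintegral_congr fun t => (hlim t).liminf_eq.symm
    _ ≤ liminf (fun S : Finset ℤ => ∫⁻ t : ℝ, ‖∑ k ∈ S, x k * csinc (t - k)‖ₑ ^ p) atTop := by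
        refine lintegral_liminf_le fun S => ?_
        have : Continuous fun t : ℝ => ∑ k ∈ S, x k * csinc (t - k) :=
          (differentiable_sum_csinc S x).continuous.comp Complex.continuous_ofReal
        exact (this.measurable.enorm).pow_const p
    _ ≤ C * ∑' k : ℤ, ‖x k‖ₑ ^ p := by
        refine liminf_le_of_le (by isBoundedDefault) fun b hb => ?_
        obtain ⟨S, hS⟩ := hb.exists
        exact hS.trans ((hCb S x).trans (by gcongr; exact ENNReal.sum_le_tsum S))

lemma shannonSeries_mem_bernsteinSpace {p : ℝ} (hp : 1 < p) {x : ℤ → ℂ} (hx : x ∈ ellSpace p) :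
    shannonSeries x ∈ bernsteinSpace Real.pi p := by
  have hd := differentiable_shannonSeries hp hx
  have hp0 : 0 < p := by linarith
  have hm : AEStronglyMeasurable (fun t : ℝ => shannonSeries x t) volume :=
    (hd.continuous.comp Complex.continuous_ofReal).aestronglyMeasurable
  obtain ⟨M, hM, hMb⟩ := exists_enorm_shannonSeries_le hp
  have hA : M * ellNorm p x ≠ ∞ := ENNReal.mul_ne_top hM (ellNorm_ne_top hx)
  have hbound : ∀ z : ℂ, ‖shannonSeries x z‖
      ≤ (M * ellNorm p x).toReal * Real.exp (Real.pi * |z.im|) := fun z => by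
    have h := ENNReal.toReal_mono (ENNReal.mul_ne_top hA (by simp)) (hMb x z)
    rwa [toReal_enorm, ENNReal.toReal_mul, ENNReal.toReal_ofReal (by positivity)] at h
  refine ⟨⟨⟨hd, fun ε hε => ⟨(M * ellNorm p x).toReal, fun z => (hbound z).trans ?_⟩⟩, ?_,
    tendsto_shannonSeries_cocompact hp hx⟩, hm, ?_⟩
  · gcongr
    · linarith
    · exact Complex.abs_im_le_norm z
  · refine memLp_top_of_bound hm (M * ellNorm p x).toReal (Eventually.of_forall fun t => ?_)
    simpa using hbound t
  · obtain ⟨C, hC, hCb⟩ := exists_lintegral_shannonSeries_le hp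
    rw [eLpNorm_lt_top_iff_lintegral_rpow_enorm_lt_top (by simpa using hp0) (by simp),
      ENNReal.toReal_ofReal hp0.le]
    exact lt_of_le_of_lt (hCb x hx)
      (ENNReal.mul_ne_top hC ((mem_ellSpace_iff hp0 x).1 hx)).lt_top

lemma csinc_intCast (k : ℤ) : csinc k = if k = 0 then 1 else 0 := by
  unfold csinc
  by_cases hk : k = 0
  · simp [hk]
  · simp [hk, mul_comm (Real.pi : ℂ) (k : ℂ), Complex.sin_int_mul_pi]

lemma sampling_shannonSeries (x : ℤ → ℂ) : sampling (shannonSeries x) = x := by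
  funext j
  rw [sampling, shannonSeries, tsum_eq_single j]
  · simp [csinc]
  · intro k hk
    rw [← Int.cast_sub, csinc_intCast, if_neg (sub_ne_zero.2 hk.symm), mul_zero]

/-! ### Uniqueness: bandlimited signals that vanish at infinity and at the integers -/

/-- Phragmén-Lindelöf for `f (i w) exp (-(σ + ε) w)` on the right half-plane: it is bounded by `B`
on the imaginary axis and bounded on the positive real axis. Then `ε → 0`. -/
lemma norm_le_mul_exp_of_im_nonneg {σ B : ℝ} {f : ℂ → ℂ} (hf : IsEntireOfExpType σ f)
    (hB : ∀ t : ℝ, ‖f t‖ ≤ B) {z : ℂ} (hz : 0 ≤ z.im) :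
    ‖f z‖ ≤ B * Real.exp (σ * z.im) := by
  have key : ∀ ε : ℝ, 0 < ε → ‖f z‖ ≤ B * Real.exp ((σ + ε) * z.im) := by
    intro ε hε
    obtain ⟨A, hA⟩ := hf.2 ε hε
    have hA0 : 0 ≤ A := by
      have := (norm_nonneg _).trans (hA 0)
      simpa using this
    set F : ℂ → ℂ := fun w => f (Complex.I * w) * Complex.exp (-((σ + ε : ℝ) : ℂ) * w) with hF
    have hn : ∀ w, ‖F w‖ = ‖f (Complex.I * w)‖ * Real.exp (-(σ + ε) * w.re) := fun w => by
      rw [hF]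
      simp only
      rw [norm_mul, Complex.norm_exp, ← Complex.ofReal_neg, Complex.re_ofReal_mul]
    have hd : Differentiable ℂ F := by
      have h1 : Differentiable ℂ fun w => f (Complex.I * w) := hf.1.comp (by fun_prop)
      exact h1.mul (by fun_prop)
    -- The growth order is 1, below the critical order 2 of a half-plane.
    have h := PhragmenLindelof.right_half_plane_of_bounded_on_real (f := F) (C := B)
      (z := -Complex.I * z) hd.diffContOnCl ⟨1, by norm_num, |σ + ε| + |σ + ε|, ?_⟩ ?_ ?_ ?_
    · rw [hn] at h
      have e1 : Complex.I * (-Complex.I * z) = z := by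
        rw [← mul_assoc, mul_neg, Complex.I_mul_I, neg_neg, one_mul]
      have e2 : (-Complex.I * z).re = z.im := by simp
      rw [e1, e2] at h
      calc ‖f z‖ = ‖f z‖ * Real.exp (-(σ + ε) * z.im) * Real.exp ((σ + ε) * z.im) := by
            rw [mul_assoc, ← Real.exp_add, neg_mul, neg_add_cancel, Real.exp_zero, mul_one]
        _ ≤ _ := by gcongr
    · refine Asymptotics.IsBigO.of_bound A (Eventually.of_forall fun w => ?_)
      rw [hn, Real.norm_of_nonneg (Real.exp_pos _).le, Real.rpow_one, add_mul, Real.exp_add,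
        ← mul_assoc]
      have h1 := hA (Complex.I * w)
      rw [norm_mul, Complex.norm_I, one_mul] at h1
      have h2 : (σ + ε) * ‖w‖ ≤ |σ + ε| * ‖w‖ := by gcongr; exact le_abs_self _
      have h3 : -(σ + ε) * w.re ≤ |σ + ε| * ‖w‖ := by
        refine (le_abs_self _).trans ?_
        rw [abs_mul, abs_neg]
        gcongr
        exact Complex.abs_re_le_norm w
      gcongr
      exact h1.trans (by gcongr)
    · refine isBoundedUnder_of_eventually_le (a := A) ?_
      filter_upwards [eventually_ge_atTop 0] with x hx
      rw [hn, Complex.ofReal_re]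
      have h1 := hA (Complex.I * x)
      rw [norm_mul, Complex.norm_I, one_mul, Complex.norm_real, Real.norm_of_nonneg hx] at h1
      calc ‖f (Complex.I * x)‖ * Real.exp (-(σ + ε) * x)
          ≤ A * Real.exp ((σ + ε) * x) * Real.exp (-(σ + ε) * x) := by gcongr
        _ = A := by
            rw [mul_assoc, ← Real.exp_add, neg_mul, add_neg_cancel, Real.exp_zero, mul_one]
    · intro x
      rw [hn]
      have e : Complex.I * ((x : ℂ) * Complex.I) = ((-x : ℝ) : ℂ) := by
        rw [mul_left_comm, Complex.I_mul_I]; push_cast; ring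
      rw [e]
      simpa using hB (-x)
    · simpa using hz
  have hlim : Tendsto (fun ε : ℝ => B * Real.exp ((σ + ε) * z.im)) (𝓝[>] 0)
      (𝓝 (B * Real.exp ((σ + 0) * z.im))) :=
    ((by fun_prop : Continuous fun ε : ℝ => B * Real.exp ((σ + ε) * z.im)).tendsto 0).mono_left
      nhdsWithin_le_nhds
  rw [add_zero] at hlim
  refine ge_of_tendsto hlim ?_
  filter_upwards [self_mem_nhdsWithin] with ε hε using key ε hε

/-- A function of exponential type `σ` bounded by `B` on the real line is bounded by
`B exp (σ |Im z|)`. -/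
lemma norm_le_mul_exp_abs_im {σ B : ℝ} {f : ℂ → ℂ} (hf : IsEntireOfExpType σ f)
    (hB : ∀ t : ℝ, ‖f t‖ ≤ B) (z : ℂ) : ‖f z‖ ≤ B * Real.exp (σ * |z.im|) := by
  rcases le_total 0 z.im with hz | hz
  · rw [abs_of_nonneg hz]
    exact norm_le_mul_exp_of_im_nonneg hf hB hz
  · have hg : IsEntireOfExpType σ fun w => f (-w) :=
      ⟨hf.1.comp differentiable_neg, fun ε hε => by
        obtain ⟨A, hA⟩ := hf.2 ε hε
        exact ⟨A, fun w => by simpa using hA (-w)⟩⟩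
    have h := norm_le_mul_exp_of_im_nonneg (z := -z) hg (B := B)
      (fun t => by simpa using hB (-t)) (by simpa using hz)
    rw [abs_of_nonpos hz]
    simpa using h

lemma exists_norm_le_of_tendsto_cocompact {g : ℝ → ℂ} (hg : Continuous g)
    (h0 : Tendsto g (cocompact ℝ) (𝓝 0)) : ∃ B : ℝ, ∀ t, ‖g t‖ ≤ B := by
  have h1 : ∀ᶠ t in cocompact ℝ, ‖g t‖ ≤ 1 := by
    filter_upwards [Metric.tendsto_nhds.1 h0 1 one_pos] with t ht
    rw [dist_zero_right] at ht
    exact ht.le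
  obtain ⟨K, hK, hK1⟩ := mem_cocompact.1 h1
  obtain ⟨C, hC⟩ := hK.exists_bound_of_continuousOn hg.continuousOn
  refine ⟨max C 1, fun t => ?_⟩
  by_cases ht : t ∈ K
  · exact (hC t ht).trans (le_max_left _ _)
  · exact (hK1 ht).trans (le_max_right _ _)

/-- Division of entire functions by an entire function with simple zeros. -/
lemma exists_differentiable_eq_mul {f g : ℂ → ℂ} (hf : Differentiable ℂ f)
    (hg : Differentiable ℂ g) (h : ∀ z, g z = 0 → f z = 0 ∧ deriv g z ≠ 0) :
    ∃ q : ℂ → ℂ, Differentiable ℂ q ∧ ∀ z, f z = q z * g z := by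
  classical
  -- At a zero of `g` the value is the l'Hôpital limit, so near it the quotient agrees with a
  -- quotient of `dslope`s.
  refine ⟨fun z => if g z = 0 then deriv f z / deriv g z else f z / g z, fun z₀ => ?_,
    fun z => ?_⟩
  · by_cases h0 : g z₀ = 0
    · obtain ⟨hf0, hg0⟩ := h z₀ h0
      have hds : ∀ u : ℂ → ℂ, Differentiable ℂ u → Differentiable ℂ (dslope u z₀) := by
        intro u hu
        rw [← differentiableOn_univ, Complex.differentiableOn_dslope (by simp)]
        exact hu.differentiableOn
      have hne : dslope g z₀ z₀ ≠ 0 := by rwa [dslope_same]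
      have hev : ∀ᶠ z in 𝓝 z₀, dslope g z₀ z ≠ 0 :=
        (hds g hg).continuous.continuousAt.eventually_ne hne
      refine ((hds f hf z₀).div (hds g hg z₀) hne).congr_of_eventuallyEq ?_
      filter_upwards [hev] with z hz
      rcases eq_or_ne z z₀ with rfl | hzz
      · simp [h0]
      · have e1 : g z = (z - z₀) * dslope g z₀ z := by
          have := sub_smul_dslope g z₀ z
          rw [h0, sub_zero, smul_eq_mul] at this
          exact this.symm
        have e2 : f z = (z - z₀) * dslope f z₀ z := by
          have := sub_smul_dslope f z₀ z
          rw [hf0, sub_zero, smul_eq_mul] at this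
          exact this.symm
        have hz1 : z - z₀ ≠ 0 := sub_ne_zero.2 hzz
        have hgz : g z ≠ 0 := by rw [e1]; exact mul_ne_zero hz1 hz
        simp only [if_neg hgz, Pi.div_apply]
        rw [e1, e2, mul_div_mul_left _ _ hz1]
    · have hev : ∀ᶠ z in 𝓝 z₀, g z ≠ 0 := hg.continuous.continuousAt.eventually_ne h0
      refine ((hf z₀).div (hg z₀) h0).congr_of_eventuallyEq ?_
      filter_upwards [hev] with z hz
      simp [hz]
  · simp only
    split_ifs with h0
    · rw [h0, mul_zero, (h z h0).1]
    · rw [div_mul_cancel₀ _ h0]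

lemma sub_exp_le_norm_sin (w : ℂ) :
    Real.exp |w.im| - Real.exp (-|w.im|) ≤ 2 * ‖Complex.sin w‖ := by
  have e : 2 * ‖Complex.sin w‖
      = ‖Complex.exp (-w * Complex.I) - Complex.exp (w * Complex.I)‖ := by
    rw [Complex.sin, norm_div, norm_mul, Complex.norm_I, Complex.norm_ofNat]; ring
  have h1 : ‖Complex.exp (-w * Complex.I)‖ = Real.exp w.im := by rw [Complex.norm_exp]; simp
  have h2 : ‖Complex.exp (w * Complex.I)‖ = Real.exp (-w.im) := by rw [Complex.norm_exp]; simp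
  rw [e]
  rcases le_total 0 w.im with h | h
  · rw [abs_of_nonneg h, ← h1, ← h2]
    exact norm_sub_norm_le _ _
  · rw [abs_of_nonpos h, neg_neg, ← h1, ← h2, norm_sub_rev]
    exact norm_sub_norm_le _ _

lemma exp_le_norm_sin_of_one_le_abs_im {z : ℂ} (hz : 1 ≤ |z.im|) :
    Real.exp (Real.pi * |z.im|) ≤ 4 * ‖Complex.sin (Real.pi * z)‖ := by
  have h := sub_exp_le_norm_sin (Real.pi * z)
  rw [Complex.im_ofReal_mul, abs_mul, abs_of_pos Real.pi_pos] at h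
  set u := Real.pi * |z.im| with hu
  have hu1 : 1 ≤ u := by nlinarith [Real.pi_gt_three]
  have h1 : 2 ≤ Real.exp u := by linarith [Real.add_one_le_exp u]
  have h2 : Real.exp (-u) ≤ 1 := Real.exp_le_one_iff.2 (by linarith)
  linarith

/-- On vertical lines through half-integers `|sin (π z)| = cosh (π Im z)`. These lines serve as box
sides that avoid the zeros of the sine. -/
lemma exp_le_norm_sin_of_re_eq {z : ℂ} {n : ℤ} (hz : z.re = n + 1 / 2) :
    Real.exp (Real.pi * |z.im|) ≤ 4 * ‖Complex.sin (Real.pi * z)‖ := by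
  have e : (Real.pi : ℂ) * z = (Real.pi * z.im : ℝ) * Complex.I + Real.pi / 2 + n * Real.pi := by
    conv_lhs => rw [← Complex.re_add_im z, hz]
    push_cast; ring
  have h1 : ‖Complex.sin (Real.pi * z)‖ = Real.cosh (Real.pi * z.im) := by
    rw [e, Complex.sin_antiperiodic.add_int_mul_eq, Complex.sin_add_pi_div_two, Complex.cos_mul_I,
      norm_mul, Int.cast_negOnePow, norm_zpow, norm_neg, norm_one, one_zpow, one_mul,
      ← Complex.ofReal_cosh, Complex.norm_real, Real.norm_of_nonneg (Real.cosh_pos _).le]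
  rw [h1, ← Real.cosh_abs, abs_mul, abs_of_pos Real.pi_pos, Real.cosh_eq]
  linarith [Real.exp_pos (Real.pi * |z.im|), Real.exp_pos (-(Real.pi * |z.im|))]

lemma eq_zero_of_sin_pi_mul_eq_zero {z : ℂ} (hz : Complex.sin (Real.pi * z) = 0) :
    ∃ k : ℤ, z = k := by
  obtain ⟨k, hk⟩ := Complex.sin_eq_zero_iff.1 hz
  refine ⟨k, ?_⟩
  have hpi : (Real.pi : ℂ) ≠ 0 := by exact_mod_cast Real.pi_ne_zero
  rw [mul_comm] at hk
  exact mul_right_cancel₀ hpi hk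

/-- A function of exponential type at most `π` that vanishes at the integers and, along the real
line, at infinity, is zero. -/
lemma eq_zero_of_sampling_eq_zero {f : ℂ → ℂ} (hf : f ∈ bernsteinSpaceTop Real.pi)
    (h0 : sampling f = 0) : f = 0 := by
  obtain ⟨hexp, -, hlim⟩ := hf
  obtain ⟨B, hB⟩ := exists_norm_le_of_tendsto_cocompact
    (hexp.1.continuous.comp Complex.continuous_ofReal) hlim
  have hbound := norm_le_mul_exp_abs_im hexp hB
  have hB0 : 0 ≤ B := (norm_nonneg _).trans (hB 0)
  have hsin : Differentiable ℂ fun z : ℂ => Complex.sin (Real.pi * z) := by fun_prop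
  have hpi : (Real.pi : ℂ) ≠ 0 := by exact_mod_cast Real.pi_ne_zero
  obtain ⟨q, hq, hfq⟩ := exists_differentiable_eq_mul hexp.1 hsin (fun z hz => by
    refine ⟨?_, ?_⟩
    · obtain ⟨k, rfl⟩ := eq_zero_of_sin_pi_mul_eq_zero hz
      exact congrFun h0 k
    · have hd : HasDerivAt (fun z : ℂ => Complex.sin (Real.pi * z))
          (Complex.cos (Real.pi * z) * Real.pi) z := by
        simpa using ((hasDerivAt_id z).const_mul (Real.pi : ℂ)).csin
      rw [hd.deriv]
      refine mul_ne_zero (fun hc => ?_) hpi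
      have := Complex.sin_sq_add_cos_sq (Real.pi * z)
      rw [hz, hc] at this
      norm_num at this)
  have hqle : ∀ z : ℂ, Real.exp (Real.pi * |z.im|) ≤ 4 * ‖Complex.sin (Real.pi * z)‖ →
      ‖q z‖ ≤ 4 * B := fun z hz => by
    have h1 := hbound z
    rw [hfq, norm_mul] at h1
    have h2 : 0 < ‖Complex.sin (Real.pi * z)‖ := by
      linarith [Real.exp_pos (Real.pi * |z.im|)]
    refine le_of_mul_le_mul_right ?_ h2
    calc ‖q z‖ * ‖Complex.sin (Real.pi * z)‖ ≤ B * Real.exp (Real.pi * |z.im|) := h1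
      _ ≤ B * (4 * ‖Complex.sin (Real.pi * z)‖) := by gcongr
      _ = _ := by ring
  have hqb : ∀ z, ‖q z‖ ≤ 4 * B := fun z => by
    rcases le_or_gt 1 |z.im| with hz | hz
    · exact hqle z (exp_le_norm_sin_of_one_le_abs_im hz)
    · set n := ⌊z.re⌋
      -- The sine may vanish inside this box, but its lower bounds hold on all four sides, so the
      -- maximum principle applies to `q`.
      set U : Set ℂ := Set.Ioo ((n : ℝ) - 1 / 2) (n + 3 / 2) ×ℂ Set.Ioo (-1 : ℝ) 1 with hU
      have hzU : z ∈ U := by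
        have a1 := Int.floor_le z.re
        have a2 := Int.lt_floor_add_one z.re
        rw [abs_lt] at hz
        exact ⟨⟨by linarith, by linarith⟩, hz⟩
      have hUb : Bornology.IsBounded U :=
        (Metric.isBounded_Ioo _ _).reProdIm (Metric.isBounded_Ioo _ _)
      refine Complex.norm_le_of_forall_mem_frontier_norm_le hUb hq.diffContOnCl (fun w hw => ?_)
        (subset_closure hzU)
      rw [hU, Complex.frontier_reProdIm, frontier_Ioo (by linarith), frontier_Ioo (by linarith)]
        at hw
      rcases hw with hw | hw
      · have := hw.2
        simp only [Set.mem_preimage, Set.mem_insert_iff, Set.mem_singleton_iff] at this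
        apply hqle
        apply exp_le_norm_sin_of_one_le_abs_im
        rcases this with h | h <;> simp [h]
      · have := hw.1
        simp only [Set.mem_preimage, Set.mem_insert_iff, Set.mem_singleton_iff] at this
        apply hqle
        rcases this with h | h
        · apply exp_le_norm_sin_of_re_eq (n := n - 1)
          rw [h]; push_cast; ring
        · apply exp_le_norm_sin_of_re_eq (n := n + 1)
          rw [h]; push_cast; ring
  have hconst : ∀ z, q z = q 0 := fun z => by
    refine hq.apply_eq_apply_of_bounded ?_ z 0
    rw [isBounded_iff_forall_norm_le]
    exact ⟨4 * B, by rintro _ ⟨w, rfl⟩; exact hqb w⟩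
  -- At half-integers `|sin (π t)| = 1`, so the decay of `f` forces the constant `q` to be zero.
  have hseq : Tendsto (fun n : ℕ => ((n : ℝ) + 1 / 2)) atTop (cocompact ℝ) :=
    (tendsto_atTop_add_const_right _ _ tendsto_natCast_atTop_atTop).mono_right
      atTop_le_cocompact
  have hlim4 : Tendsto (fun n : ℕ => 4 * ‖f ((n + 1 / 2 : ℝ) : ℂ)‖) atTop (𝓝 0) := by
    have := ((hlim.comp hseq).norm).const_mul 4
    rwa [norm_zero, mul_zero] at this
  have hq0 : ‖q 0‖ ≤ 0 := by
    refine ge_of_tendsto hlim4 (Eventually.of_forall fun n => ?_)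
    have h1 := exp_le_norm_sin_of_re_eq (z := ((n + 1 / 2 : ℝ) : ℂ)) (n := n)
      (by rw [Complex.ofReal_re]; push_cast; ring)
    rw [Complex.ofReal_im, abs_zero, mul_zero, Real.exp_zero] at h1
    rw [hfq, hconst ((n + 1 / 2 : ℝ) : ℂ), norm_mul]
    nlinarith [norm_nonneg (q 0)]
  funext z
  rw [hfq, hconst, norm_le_zero_iff.1 hq0, zero_mul, Pi.zero_apply]

/-! ### The interpolation operator -/

lemma sub_mem_bernsteinSpace {σ p : ℝ} {f g : ℂ → ℂ} (hf : f ∈ bernsteinSpace σ p)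
    (hg : g ∈ bernsteinSpace σ p) : f - g ∈ bernsteinSpace σ p := by
  obtain ⟨⟨⟨hfd, hfe⟩, hft, hf0⟩, hfp⟩ := hf
  obtain ⟨⟨⟨hgd, hge⟩, hgt, hg0⟩, hgp⟩ := hg
  refine ⟨⟨⟨hfd.sub hgd, fun ε hε => ?_⟩, hft.sub hgt, ?_⟩, hfp.sub hgp⟩
  · obtain ⟨A, hA⟩ := hfe ε hε
    obtain ⟨B, hB⟩ := hge ε hε
    refine ⟨A + B, fun z => (norm_sub_le _ _).trans ?_⟩
    rw [add_mul]
    exact add_le_add (hA z) (hB z)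
  · simpa using hf0.sub hg0

lemma eq_shannonSeries_of_mem_bernsteinSpace {p : ℝ} (hp : 1 < p) {f : ℂ → ℂ}
    (hf : f ∈ bernsteinSpace Real.pi p) (hx : sampling f ∈ ellSpace p) :
    f = shannonSeries (sampling f) := by
  have h := sub_mem_bernsteinSpace hf (shannonSeries_mem_bernsteinSpace hp hx)
  refine sub_eq_zero.1 (eq_zero_of_sampling_eq_zero h.1 ?_)
  funext k
  have := congrFun (sampling_shannonSeries (sampling f)) k
  simp only [sampling] at this
  simp only [sampling, Pi.sub_apply, Pi.zero_apply]
  rw [this, sub_self]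

lemma exists_plancherelPolyaRight {p : ℝ} (hp : 1 < p) :
    ∃ C : ℝ, 0 < C ∧ PlancherelPolyaRight p C := by
  obtain ⟨C, hC, hCb⟩ := exists_lintegral_shannonSeries_le hp
  have hp0 : 0 < p := by linarith
  have hC0 : 0 < C.toReal + 1 := by positivity
  -- The `+ 1` makes the constant positive, so the right side is `∞` when the samples are not in
  -- `ℓ^p`.
  refine ⟨C.toReal + 1, hC0, fun f hf => ?_⟩
  by_cases hx : sampling f ∈ ellSpace p
  · calc ∫⁻ t : ℝ, ‖f t‖ₑ ^ p = ∫⁻ t : ℝ, ‖shannonSeries (sampling f) t‖ₑ ^ p := by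
          rw [← eq_shannonSeries_of_mem_bernsteinSpace hp hf hx]
      _ ≤ C * ∑' k : ℤ, ‖sampling f k‖ₑ ^ p := hCb _ hx
      _ ≤ _ := by
          gcongr
          rw [← ENNReal.ofReal_toReal hC]
          exact ENNReal.ofReal_le_ofReal (by simp)
  · rw [mem_ellSpace_iff hp0, not_not] at hx
    rw [hx, ENNReal.mul_top (by simpa using hC0)]
    exact le_top

/-- Taking `p`-th roots gives `C ^ (1 / p)`. The natural-number ceiling supplies the `max {0, ·}`,
so the power of two is at least 1 and its root with `1 / p ≤ 1` does not exceed it. -/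
lemma PlancherelPolyaRight.bernsteinNorm_le {p C : ℝ} (hp : 1 < p)
    (h : PlancherelPolyaRight p C) {f : ℂ → ℂ} (hf : f ∈ bernsteinSpace Real.pi p) :
    bernsteinNorm p f ≤ 2 ^ ⌈Real.logb 2 C⌉₊ * ellNorm p (sampling f) := by
  have hp0 : 0 < p := by linarith
  have hC : C ≤ (2 : ℝ) ^ ⌈Real.logb 2 C⌉₊ := by
    rcases le_or_gt C 0 with h0 | h0
    · exact h0.trans (by positivity)
    · rw [← Real.rpow_natCast, ← Real.logb_le_iff_le_rpow (by norm_num) h0]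
      exact Nat.le_ceil _
  have hC2 : ENNReal.ofReal C ≤ 2 ^ ⌈Real.logb 2 C⌉₊ := by
    refine (ENNReal.ofReal_le_ofReal hC).trans (le_of_eq ?_)
    rw [ENNReal.ofReal_pow (by norm_num)]
    simp
  rw [bernsteinNorm_eq hp0, ellNorm_eq hp0]
  calc (∫⁻ t : ℝ, ‖f t‖ₑ ^ p) ^ (1 / p)
      ≤ (2 ^ ⌈Real.logb 2 C⌉₊ * ∑' k : ℤ, ‖sampling f k‖ₑ ^ p) ^ (1 / p) := by
        gcongr
        exact (h f hf).trans (by gcongr)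
    _ = (2 ^ ⌈Real.logb 2 C⌉₊ : ℝ≥0∞) ^ (1 / p) * (∑' k : ℤ, ‖sampling f k‖ₑ ^ p) ^ (1 / p) :=
        ENNReal.mul_rpow_of_nonneg _ _ (by positivity)
    _ ≤ _ := by
        gcongr
        calc (2 ^ ⌈Real.logb 2 C⌉₊ : ℝ≥0∞) ^ (1 / p) ≤ (2 ^ ⌈Real.logb 2 C⌉₊ : ℝ≥0∞) ^ (1 : ℝ) := by
              apply ENNReal.rpow_le_rpow_of_exponent_le
              · exact one_le_pow₀ (by norm_num)
              · rw [div_le_one hp0]; exact hp.le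
          _ = _ := ENNReal.rpow_one _

lemma finiteSeq_mem_ellSpace {p : ℝ} (hp : 0 < p) (L : ℕ) (c : ℕ → ℂ) :
    finiteSeq L c ∈ ellSpace p := by
  rw [mem_ellSpace_iff hp, tsum_eq_sum (s := Finset.Icc (-(L : ℤ)) L)]
  · exact ENNReal.sum_ne_top.2 fun k _ => ENNReal.rpow_ne_top_of_nonneg hp.le enorm_ne_top
  · intro k hk
    rw [finiteSeq, if_neg (by simpa using hk), enorm_zero, ENNReal.zero_rpow_of_pos hp]

lemma finiteSamplingSeries_eq (L : ℕ) (c : ℕ → ℂ) :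
    finiteSamplingSeries L c = shannonSeries (finiteSeq L c) := by
  funext z
  rw [shannonSeries, tsum_eq_sum (s := Finset.Icc (-(L : ℤ)) L), finiteSamplingSeries]
  · refine Finset.sum_congr rfl fun k hk => ?_
    rw [finiteSeq, if_pos (by simpa using hk)]
  · intro k hk
    rw [finiteSeq, if_neg (by simpa using hk), zero_mul]

lemma finiteSamplingSeries_mem_bernsteinSpace {p : ℝ} (hp : 1 < p) (L : ℕ) (c : ℕ → ℂ) :
    finiteSamplingSeries L c ∈ bernsteinSpace Real.pi p := by
  rw [finiteSamplingSeries_eq]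
  exact shannonSeries_mem_bernsteinSpace hp (finiteSeq_mem_ellSpace (by linarith) L c)

lemma sampling_finiteSamplingSeries (L : ℕ) (c : ℕ → ℂ) :
    sampling (finiteSamplingSeries L c) = finiteSeq L c := by
  rw [finiteSamplingSeries_eq, sampling_shannonSeries]

/-! ### The interpolation program -/

/-- The program that adds `K` to its input. -/
def addCode : ℕ → Nat.Partrec.Code
  | 0 => Nat.Partrec.Code.id
  | K + 1 => Nat.Partrec.Code.comp Nat.Partrec.Code.succ (addCode K)

lemma eval_comp_of_eval_eq_some {c d : Nat.Partrec.Code} {n m : ℕ}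
    (h : d.eval n = Part.some m) : (Nat.Partrec.Code.comp c d).eval n = c.eval m := by
  change d.eval n >>= c.eval = c.eval m
  rw [h]
  exact Part.bind_some m c.eval

lemma eval_addCode (K n : ℕ) : (addCode K).eval n = Part.some (K + n) := by
  induction K with
  | zero => simp [addCode]
  | succ K ih =>
    refine (eval_comp_of_eval_eq_some ih).trans ?_
    rw [add_right_comm]
    rfl

/-- The interpolation algorithm: the coefficients are kept, the modulus of convergence is
shifted by `K`. -/
def interpolationProgram (K : ℕ) (X : SignalCode) : SignalCode :=
  (X.1, Nat.Partrec.Code.comp X.2 (addCode K))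

lemma computable_interpolationProgram (K : ℕ) : Computable (interpolationProgram K) :=
  (Primrec.fst.pair (Nat.Partrec.Code.primrec₂_comp.comp Primrec.snd
    (Primrec.const (addCode K)))).to_comp

lemma eval_interpolationProgram (K : ℕ) (X : SignalCode) (M : ℕ) :
    (interpolationProgram K X).2.eval M = X.2.eval (K + M) :=
  eval_comp_of_eval_eq_some (eval_addCode K M)

/-- Plancherel-Pólya is applied to the error `f - f_n`, whose samples are `x - x_n`; the shift by
`K` cancels the factor `2 ^ K`. -/
lemma isContinuousTimeDescription_interpolationProgram {p C : ℝ} (hp : 1 < p)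
    (h : PlancherelPolyaRight p C) {X : SignalCode} {x : ℤ → ℂ}
    (hX : IsDiscreteTimeDescription p X x) {f : ℂ → ℂ} (hf : f ∈ bernsteinSpace Real.pi p)
    (hfx : sampling f = x) :
    IsContinuousTimeDescription p (interpolationProgram ⌈Real.logb 2 C⌉₊ X) f := by
  obtain ⟨-, xs, ξ, ⟨L, c, hd, hxs⟩, hξ, hconv⟩ := hX
  set K := ⌈Real.logb 2 C⌉₊ with hK
  refine ⟨hf, fun n => finiteSamplingSeries (L n) (c n), fun M => ξ (K + M),
    ⟨L, c, hd, fun _ => rfl⟩, fun M => ?_, fun M n hn => ?_⟩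
  · rw [eval_interpolationProgram, hξ]
  · have hmem := sub_mem_bernsteinSpace hf
      (finiteSamplingSeries_mem_bernsteinSpace hp (L n) (c n))
    have hs : sampling (f - finiteSamplingSeries (L n) (c n)) = x - xs n := by
      rw [hxs, ← sampling_finiteSamplingSeries, ← hfx]
      rfl
    refine (h.bernsteinNorm_le hp hmem).trans ?_
    rw [hs]
    calc 2 ^ K * ellNorm p (x - xs n) ≤ 2 ^ K * ((2 : ℝ≥0∞) ^ (K + M))⁻¹ := by
          gcongr
          exact hconv _ _ hn
      _ = ((2 : ℝ≥0∞) ^ M)⁻¹ := by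
          rw [pow_add, ENNReal.mul_inv (by simp) (by simp), ← mul_assoc,
            ENNReal.mul_inv_cancel (by simp) (by simp), one_mul]

lemma computesInterpolation_interpolationProgram {p C : ℝ} (hp : 1 < p)
    (h : PlancherelPolyaRight p C) :
    ComputesInterpolation p fun X => Part.some (interpolationProgram ⌈Real.logb 2 C⌉₊ X) := by
  refine ⟨computable_interpolationProgram _, fun X x hX => ⟨_, Part.mem_some _, ?_, ?_⟩⟩
  · exact ⟨shannonSeries x, isContinuousTimeDescription_interpolationProgram hp h hX
      (shannonSeries_mem_bernsteinSpace hp hX.1) (sampling_shannonSeries x)⟩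
  · intro f hf hfx
    exact isContinuousTimeDescription_interpolationProgram hp h hX hf hfx

theorem theorem3 (p : ℝ) (hp : IsComputableReal p) (hp1 : 1 < p) :
    InterpolationComputable p ∧
    (∃ C : ℝ, 0 < C ∧ PlancherelPolyaRight p C) ∧
    (∀ C : ℝ, 0 < C → PlancherelPolyaRight p C →
      ∃ Φ : SignalCode →. SignalCode, ComputesInterpolation p Φ ∧
        ∀ (X : SignalCode) (x : ℤ → ℂ), IsDiscreteTimeDescription p X x → ∀ F ∈ Φ X,
          (∀ M : ℕ, F.2.eval M = X.2.eval (⌈Real.logb 2 C⌉₊ + M)) ∧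
          ∀ xs : ℕ → ℤ → ℂ, TupleSeqCode.DescribesSeqs X.1 xs →
            ∃ fs : ℕ → ℂ → ℂ, TupleSeqCode.DescribesFuns F.1 fs ∧
              ∀ n, fs n ∈ bernsteinSpace Real.pi p ∧ sampling (fs n) = xs n) := by
  obtain ⟨C₀, hC₀, hPP⟩ := exists_plancherelPolyaRight hp1
  refine ⟨⟨_, computesInterpolation_interpolationProgram hp1 hPP⟩, ⟨C₀, hC₀, hPP⟩,
    fun C _ hC => ⟨_, computesInterpolation_interpolationProgram hp1 hC, ?_⟩⟩
  intro X x _ F hF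
  obtain rfl := Part.mem_some_iff.1 hF
  refine ⟨eval_interpolationProgram _ X, ?_⟩
  rintro xs ⟨L, c, hd, hxs⟩
  refine ⟨fun n => finiteSamplingSeries (L n) (c n), ⟨L, c, hd, fun _ => rfl⟩, fun n => ⟨?_, ?_⟩⟩
  · exact finiteSamplingSeries_mem_bernsteinSpace hp1 _ _
  · rw [sampling_finiteSamplingSeries, hxs]
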